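/- Let $\mu$ be a measure on a measurable space $\mathcal X$, $T:\mathcal X\to\mathbb R$ measurable, $A(\theta)=\log\int e^{\theta T}\,d\mu$, and let $\Theta\subseteq\{\theta\in\mathbb R:\int e^{\theta T}d\mu<\infty\}$. Let $P_\theta$ have density $p_\theta(x)=\exp(\theta T(x)-A(\theta))$ with respect to $\mu$ for $\theta\in\Theta$. Let $\theta_0$ be an interior point of $\Theta$ with $\mathrm{Var}_{\theta_0}(T(X))>0$, and let $\alpha>0$. Put $J_{\theta_0}=E_{\theta_0}\big|\tfrac{\partial}{\partial\theta}\log p_\theta(X)|_{\theta=\theta_0}\big|$ (which equals $E_{\theta_0}|T(X)-E_{\theta_0}[T(X)]|$), $\Psi(t,\theta)=P_\theta(T(X)\ge t)$, $H(p,t)=\inf\{\theta\in\Theta:\Psi(t,\theta)\ge p\}\in[-\infty,+\infty]$ and $\delta_\alpha^2=e^\alpha/(e^\alpha-1)^2$. For each $n$ let $X_1,\dots,X_n$ be i.i.d. from $P_{\theta_0}$ (the second-stage sample), and let $\hat T_n$ be a real random variable (the first-stage estimate) independent of this sample, such that $\hat T_n\to E_{\theta_0}[T(X)]$ in probability as $n\to\infty$.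 Let $V_i=1\{T(X_i)\ge\hat T_n\}$ and $$Z_i=\frac{e^\alpha+1}{e^\alpha-1}\Big[\tilde V_i-\frac1{e^\alpha+1}\Big],$$ where, using independent coins that are also independent of the sample and of $\hat T_n$, $\tilde V_i=V_i$ with probability $\frac{e^\alpha}{e^\alpha+1}$ and $\tilde V_i=1-V_i$ with probability $\frac1{e^\alpha+1}$. Let $\bar Z_n=\frac1n\sum_{i=1}^nZ_i$ and $\hat\theta_n=H(\bar Z_n,\hat T_n)$. Then, for every value of the threshold $\hat T_n$, the channel $X_i\mapsto Z_i$ is $\alpha$-locally differentially private; $\hat\theta_n$ is finite with probability tending to $1$; and there exist random variables $G_n=\Psi(\hat T_n,\theta_0)\in[0,1]$, $E_{n,1}$ and $E_{n,2}$ such that $$\sqrt n\,(\hat\theta_n-\theta_0)=2J_{\theta_0}^{-1}(E_{n,1}+E_{n,2})+o_P(1),$$ where, jointly, $$\Big(E_{n,1},\ \frac{E_{n,2}}{\sqrt{G_n(1-G_n)}}\Big)\ \xrightarrow{d}\ N\big(0,\mathrm{diag}(\delta_\alpha^2,1)\big).$$ -/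

import Mathlib

open MeasureTheory ProbabilityTheory Filter Topology

noncomputable section

namespace PrivateExpFamily

variable {𝒳 : Type*} [MeasurableSpace 𝒳]

/-- Log-density `log p_θ(x) = θ T(x) - A(θ)` of the one-parameter exponential family with base
measure `μ` and sufficient statistic `T`.  Mathlib's `cgf T μ θ = log ∫ exp (θ T) dμ` is the log
partition function `A(θ)`. -/
def logDensity (μ : Measure 𝒳) (T : 𝒳 → ℝ) (θ : ℝ) (x : 𝒳) : ℝ :=
  θ * T x - cgf T μ θ

/-- The distribution `P_θ`, with density `exp (θ T(x) - A(θ))` with respect to `μ`. -/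
def expFamily (μ : Measure 𝒳) (T : 𝒳 → ℝ) (θ : ℝ) : Measure 𝒳 :=
  μ.withDensity fun x => ENNReal.ofReal (Real.exp (logDensity μ T θ x))

/-- The score `∂/∂θ log p_θ(x)`. -/
def score (μ : Measure 𝒳) (T : 𝒳 → ℝ) (θ : ℝ) (x : 𝒳) : ℝ :=
  deriv (fun s => logDensity μ T s x) θ

/-- The `L¹`-information `J_θ = E_θ |∂/∂θ log p_θ(X)|`. -/
def l1Information (μ : Measure 𝒳) (T : 𝒳 → ℝ) (θ : ℝ) : ℝ :=
  ∫ x, |score μ T θ x| ∂(expFamily μ T θ)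

/-- `Ψ(t, θ) = P_θ(T(X) ≥ t)`. -/
def Psi (μ : Measure 𝒳) (T : 𝒳 → ℝ) (t θ : ℝ) : ℝ :=
  (expFamily μ T θ).real {x | t ≤ T x}

/-- The inverse function `H(p, t) = inf {θ ∈ Θ : Ψ(t, θ) ≥ p}`, an extended real number
(in particular `+∞` when no `θ` qualifies). -/
def invPsi (μ : Measure 𝒳) (T : 𝒳 → ℝ) (Θ : Set ℝ) (p t : ℝ) : EReal :=
  sInf ((fun θ : ℝ => (θ : EReal)) '' {θ : ℝ | θ ∈ Θ ∧ p ≤ Psi μ T t θ})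

/-- The thresholded observation `V = 1{T(x) ≥ t}`. -/
def threshold (T : 𝒳 → ℝ) (t : ℝ) (x : 𝒳) : ℝ :=
  if t ≤ T x then 1 else 0

/-- The unbiased randomized response to a bit `v`: the coin `b` decides whether `v` (`b = true`) or
`1 - v` (`b = false`) is reported, and the report is then centered and rescaled. -/
def response (α v : ℝ) (b : Bool) : ℝ :=
  (Real.exp α + 1) / (Real.exp α - 1) *
    ((if b then v else 1 - v) - 1 / (Real.exp α + 1))

/-- The law of the coin: `true` with probability `e^α / (e^α + 1)`, `false` with probability
`1 / (e^α + 1)`. -/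
def coinLaw (α : ℝ) : Measure Bool :=
  ENNReal.ofReal (Real.exp α / (Real.exp α + 1)) • Measure.dirac true +
    ENNReal.ofReal (1 / (Real.exp α + 1)) • Measure.dirac false

/-- The privacy channel of the second stage: the law of the report of an individual who holds the
observation `x`, when the threshold is `t`. -/
def channel (α : ℝ) (T : 𝒳 → ℝ) (t : ℝ) (x : 𝒳) : Measure ℝ :=
  (coinLaw α).map (response α (threshold T t x))

/-- A channel `Q` is `α`-locally differentially private:
`Q(A | x) ≤ e^α Q(A | x')` for all `x`, `x'` and all measurable `A`. -/
def IsLocallyDP {𝒵 : Type*} [MeasurableSpace 𝒵] (α : ℝ) (Q : 𝒳 → Measure 𝒵) : Prop :=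
  ∀ x x' : 𝒳, ∀ A : Set 𝒵, MeasurableSet A → Q x A ≤ ENNReal.ofReal (Real.exp α) * Q x' A

/-- The average `Z̄_n = (1/n) ∑ Z_i` of the `n` private reports made with threshold `t`, observations
`x i` and coins `b i`. -/
def meanReport (α : ℝ) (T : 𝒳 → ℝ) (n : ℕ) (t : ℝ) (x : Fin n → 𝒳) (b : Fin n → Bool) : ℝ :=
  (1 / (n : ℝ)) * ∑ i, response α (threshold T t (x i)) (b i)

/-- The private estimator `θ̂_n = H(Z̄_n, t)`. -/
def estimator (μ : Measure 𝒳) (T : 𝒳 → ℝ) (Θ : Set ℝ) (α : ℝ) (n : ℕ) (t : ℝ)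
    (x : Fin n → 𝒳) (b : Fin n → Bool) : EReal :=
  invPsi μ T Θ (meanReport α T n t x b) t

/-- The noise level `δ_α² = e^α / (e^α - 1)²` of the randomized response. -/
def deltaSq (α : ℝ) : ℝ :=
  Real.exp α / (Real.exp α - 1) ^ 2

end PrivateExpFamily

end

/-! The deviation `√n (Z̄_n - G_n)` splits exactly into normalized coin noise `E₁` plus normalized
sampling error of the bits `E₂` (`noiseError_add_bitError`), and `θ̂_n` is `Z̄_n` pulled back
through `Ψ(T̂_n, ·)`. Two facts are needed.

Inversion. The slope of `Ψ(t, ·)` at `θ₀` is `E[1{T ≥ t} (T - E T)]`. At `t = E T` this is `J / 2`,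
since the positive and negative parts of a centered variable have equal means; elsewhere it is off
by at most `|t - E T|` (`abs_setIntegral_sub_half_le`). The Taylor remainder is uniform in `t`
(`exists_isLittleO_Psi_sub`), so consistency of `T̂_n` suffices, without a rate and without
continuity of the law of `T`. Monotone likelihood ratio (`Psi_mono`) then sandwiches the infimum
between two points of `Θ` at distance of order `1 / √n` from `θ₀` (`exists_invPsi_expansion`).

Central limit theorem. `G_n` need not converge, because `T` may have an atom at its mean; hence the
standardization of `E₂`. For a fixed threshold, a linear combination of `E₁` and standardized `E₂`
is a normalized i.i.d. sum of bounded centered variables whose variance `a² δ_α² + b²` does not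
depend on the threshold. Its characteristic function therefore converges uniformly over thresholds
near the mean, where the bits are non-degenerate (`exists_le_prob_mul_one_sub`), and independence of
`T̂_n` permits averaging over the threshold (`integral_cexp_sum_eq`,
`tendsto_integral_comp_of_tendstoInMeasure`). -/

namespace PrivateExpFamily

variable {𝒳 : Type*} [MeasurableSpace 𝒳]

/-! ### Exponential tilting, monotone likelihood ratio, change of reference parameter. -/

lemma expFamily_eq_tilted (μ : Measure 𝒳) (T : 𝒳 → ℝ) {θ : ℝ} (hθ : θ ∈ integrableExpSet T μ) :
    expFamily μ T θ = μ.tilted (θ * T ·) := by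
  rcases eq_zero_or_neZero μ with rfl | hμ
  · simp [expFamily]
  · have h : Integrable (fun x => Real.exp (θ * T x)) μ := hθ
    simp_rw [expFamily, Measure.tilted, logDensity, Real.exp_sub, exp_cgf h, mgf]

lemma isProbabilityMeasure_expFamily (μ : Measure 𝒳) [NeZero μ] (T : 𝒳 → ℝ) {θ : ℝ}
    (hθ : θ ∈ integrableExpSet T μ) : IsProbabilityMeasure (expFamily μ T θ) := by
  rw [expFamily_eq_tilted μ T hθ]
  exact isProbabilityMeasure_tilted hθ

lemma measurableSet_le_stat {T : 𝒳 → ℝ} (hT : Measurable T) (t : ℝ) :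
    MeasurableSet {x | t ≤ T x} :=
  measurableSet_le measurable_const hT

/-- `Ψ(t, θ)` as a ratio of exponential moments. -/
lemma Psi_eq_div (μ : Measure 𝒳) {T : 𝒳 → ℝ} (hT : Measurable T) (t : ℝ) {θ : ℝ}
    (hθ : θ ∈ integrableExpSet T μ) :
    Psi μ T t θ = (∫ x in {x | t ≤ T x}, Real.exp (θ * T x) ∂μ) / mgf T μ θ := by
  rw [Psi, expFamily_eq_tilted μ T hθ, measureReal_def,
    tilted_mul_apply_eq_ofReal_integral_mgf' (measurableSet_le_stat hT t), integral_div,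
    ENNReal.toReal_ofReal]
  exact div_nonneg (integral_nonneg fun x => (Real.exp_pos _).le) mgf_nonneg

/-- Monotone likelihood ratio: `Ψ(t, ·)` is nondecreasing on the natural parameter space. -/
lemma Psi_mono (μ : Measure 𝒳) [NeZero μ] {T : 𝒳 → ℝ} (hT : Measurable T) (t : ℝ) {θ₁ θ₂ : ℝ}
    (h₁ : θ₁ ∈ integrableExpSet T μ) (h₂ : θ₂ ∈ integrableExpSet T μ) (h : θ₁ ≤ θ₂) :
    Psi μ T t θ₁ ≤ Psi μ T t θ₂ := by
  rw [Psi_eq_div μ hT t h₁, Psi_eq_div μ hT t h₂]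
  have hs := measurableSet_le_stat hT t
  have i₁ : Integrable (fun x => Real.exp (θ₁ * T x)) μ := h₁
  have i₂ : Integrable (fun x => Real.exp (θ₂ * T x)) μ := h₂
  rw [div_le_div_iff₀ (mgf_pos' (NeZero.ne μ) i₁) (mgf_pos' (NeZero.ne μ) i₂), mgf, mgf,
    ← integral_add_compl hs i₁, ← integral_add_compl hs i₂]
  have a₁ : 0 ≤ ∫ x in {x | t ≤ T x}, Real.exp (θ₁ * T x) ∂μ :=
    integral_nonneg fun x => (Real.exp_pos _).le
  have b₁ : 0 ≤ ∫ x in {x | t ≤ T x}ᶜ, Real.exp (θ₁ * T x) ∂μ :=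
    integral_nonneg fun x => (Real.exp_pos _).le
  -- After cross-multiplying, the products of the two event integrals cancel. What remains compares
  -- the likelihood ratio `exp ((θ₂ - θ₁) T)` on the event and on its complement, and `exp ((θ₂ -
  -- θ₁) t)` separates the two.
  have ha : Real.exp ((θ₂ - θ₁) * t) * ∫ x in {x | t ≤ T x}, Real.exp (θ₁ * T x) ∂μ ≤
      ∫ x in {x | t ≤ T x}, Real.exp (θ₂ * T x) ∂μ := by
    rw [← integral_const_mul]
    refine setIntegral_mono_on (i₁.const_mul _).integrableOn i₂.integrableOn hs fun x hx => ?_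
    rw [← Real.exp_add, Real.exp_le_exp]
    have := mul_le_mul_of_nonneg_left (show t ≤ T x from hx) (sub_nonneg.2 h)
    linarith
  have hb : ∫ x in {x | t ≤ T x}ᶜ, Real.exp (θ₂ * T x) ∂μ ≤
      Real.exp ((θ₂ - θ₁) * t) * ∫ x in {x | t ≤ T x}ᶜ, Real.exp (θ₁ * T x) ∂μ := by
    rw [← integral_const_mul]
    refine setIntegral_mono_on i₂.integrableOn (i₁.const_mul _).integrableOn hs.compl
      fun x hx => ?_
    rw [← Real.exp_add, Real.exp_le_exp]
    have hx' : T x < t := not_le.1 hx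
    have := mul_le_mul_of_nonneg_left hx'.le (sub_nonneg.2 h)
    linarith
  nlinarith [mul_le_mul_of_nonneg_left hb a₁, mul_le_mul_of_nonneg_right ha b₁]

lemma integrable_exp_mul_expFamily_iff (μ : Measure 𝒳) (T : 𝒳 → ℝ) {θ₀ : ℝ}
    (hθ₀ : θ₀ ∈ integrableExpSet T μ) (h : ℝ) :
    h ∈ integrableExpSet T (expFamily μ T θ₀) ↔ θ₀ + h ∈ integrableExpSet T μ := by
  have i : Integrable (fun x => Real.exp (θ₀ * T x)) μ := hθ₀
  rw [expFamily_eq_tilted μ T hθ₀]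
  simp only [integrableExpSet, Set.mem_ofPred_eq]
  rw [integrable_tilted_iff i]
  simp [← Real.exp_add, add_mul]

lemma zero_mem_interior_expFamily (μ : Measure 𝒳) (T : 𝒳 → ℝ) {θ₀ : ℝ}
    (hθ₀ : θ₀ ∈ interior (integrableExpSet T μ)) :
    0 ∈ interior (integrableExpSet T (expFamily μ T θ₀)) := by
  rw [mem_interior_iff_mem_nhds] at hθ₀ ⊢
  have hc : Tendsto (fun h : ℝ => θ₀ + h) (𝓝 0) (𝓝 θ₀) := by
    have : ContinuousAt (fun h : ℝ => θ₀ + h) 0 := by fun_prop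
    simpa [ContinuousAt] using this
  filter_upwards [hc hθ₀] with h hh
  exact (integrable_exp_mul_expFamily_iff μ T (mem_of_mem_nhds hθ₀) h).2 hh

/-- Tilting is additive in the parameter, so the family can be rebased at `θ₀`: the reference
parameter becomes `0`, the base measure a probability, and derivatives of `mgf` at `0` are moments.
-/
lemma expFamily_expFamily (μ : Measure 𝒳) (T : 𝒳 → ℝ) {θ₀ h : ℝ}
    (hθ₀ : θ₀ ∈ integrableExpSet T μ) (hh : θ₀ + h ∈ integrableExpSet T μ) :
    expFamily (expFamily μ T θ₀) T h = expFamily μ T (θ₀ + h) := by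
  rw [expFamily_eq_tilted _ T ((integrable_exp_mul_expFamily_iff μ T hθ₀ h).2 hh),
    expFamily_eq_tilted μ T hθ₀, expFamily_eq_tilted μ T hh, tilted_tilted hθ₀]
  congr 1
  ext x
  simp [add_mul]

lemma Psi_expFamily (μ : Measure 𝒳) (T : 𝒳 → ℝ) (t : ℝ) {θ₀ h : ℝ}
    (hθ₀ : θ₀ ∈ integrableExpSet T μ) (hh : θ₀ + h ∈ integrableExpSet T μ) :
    Psi (expFamily μ T θ₀) T t h = Psi μ T t (θ₀ + h) := by
  rw [Psi, expFamily_expFamily μ T hθ₀ hh, Psi]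

/-! ### Uniform expansion of `Ψ` and non-degeneracy of the bits. -/

section Expansion

variable (ν : Measure 𝒳) [IsProbabilityMeasure ν] {T : 𝒳 → ℝ}

/-- First-order expansion of `Ψ(t, ·)` at `0`, uniform in the threshold. -/
lemma exists_isLittleO_Psi_sub (hT : Measurable T) (h0 : 0 ∈ interior (integrableExpSet T ν)) :
    ∃ r : ℝ → ℝ, r =o[𝓝 0] (fun h => h) ∧ ∀ t h : ℝ, h ∈ integrableExpSet T ν →
      |Psi ν T t h - ν.real {x | t ≤ T x} -
        h * ∫ x in {x | t ≤ T x}, (T x - ∫ y, T y ∂ν) ∂ν| ≤ r h := by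
  set m := ∫ y, T y ∂ν with hm
  have iT : Integrable T ν := integrable_of_mem_interior_integrableExpSet h0
  have dM : HasDerivAt (mgf T ν) m 0 := by
    have := hasDerivAt_mgf h0
    simpa using this
  have M0 : mgf T ν 0 = 1 := by simp
  have dI : HasDerivAt (fun h => (mgf T ν h)⁻¹) (-m) 0 := by
    have := dM.inv (by rw [M0]; exact one_ne_zero)
    rw [M0] at this
    simp only [one_pow, div_one] at this
    exact this
  have o1 := hasDerivAt_iff_isLittleO.1 dM
  have o2 := hasDerivAt_iff_isLittleO.1 dI
  simp only [M0, sub_zero, smul_eq_mul, inv_one] at o1 o2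
  have cI : Tendsto (fun h => (mgf T ν h)⁻¹) (𝓝 0) (𝓝 1) := by
    simpa [ContinuousAt, M0] using dI.continuousAt
  -- With `Ψ = N / M`, the three terms bound the error in linearizing `N`, the error in linearizing
  -- `1 / M`, and the cross term; none depends on `t`.
  refine ⟨fun h => |(mgf T ν h)⁻¹| * |mgf T ν h - 1 - h * m| + |(mgf T ν h)⁻¹ - 1 - h * -m|
      + (∫ x, |T x| ∂ν) * |h * ((mgf T ν h)⁻¹ - 1)|, ?_, ?_⟩
  · refine ((?_ : _ =o[_] _).add o2.norm_left).add ?_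
    · simp_rw [← Real.norm_eq_abs]
      have : (fun h => ‖(mgf T ν h)⁻¹‖) =O[𝓝 0] (fun _ => (1 : ℝ)) :=
        (cI.isBigO_one ℝ).norm_left
      simpa using this.mul_isLittleO o1.norm_left
    · refine Asymptotics.IsLittleO.const_mul_left ?_ _
      simp_rw [← Real.norm_eq_abs]
      refine Asymptotics.IsLittleO.norm_left ?_
      have : (fun h => (mgf T ν h)⁻¹ - 1) =o[𝓝 0] (fun _ => (1 : ℝ)) := by
        rw [Asymptotics.isLittleO_one_iff]
        simpa using cI.sub_const 1
      simpa using (Asymptotics.isBigO_refl (fun h : ℝ => h) (𝓝 0)).mul_isLittleO this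
  · intro t h hh
    have hs := measurableSet_le_stat hT t
    have ie : Integrable (fun x => Real.exp (h * T x)) ν := hh
    have Mpos : 0 < mgf T ν h := mgf_pos ie
    rw [Psi_eq_div ν hT t hh]
    have hsplit : ∫ x in {x | t ≤ T x}, (T x - m) ∂ν =
        ∫ x in {x | t ≤ T x}, T x ∂ν - ν.real {x | t ≤ T x} * m := by
      rw [integral_sub iT.integrableOn (integrable_const _)]
      simp
    have hD : |∫ x in {x | t ≤ T x}, T x ∂ν| ≤ ∫ x, |T x| ∂ν :=
      (abs_integral_le_integral_abs).trans
        (setIntegral_le_integral iT.abs (ae_of_all _ fun x => abs_nonneg _))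
    have hG0 : 0 ≤ ν.real {x | t ≤ T x} := measureReal_nonneg
    have hG1 : ν.real {x | t ≤ T x} ≤ 1 := measureReal_le_one
    -- Source of the uniformity in `t`: `exp u - 1 - u` is nonnegative, so its integral over the
    -- event is at most its integral over the whole space, which is the remainder of `mgf`.
    have hN : |∫ x in {x | t ≤ T x}, Real.exp (h * T x) ∂ν - ν.real {x | t ≤ T x} -
        h * ∫ x in {x | t ≤ T x}, T x ∂ν| ≤ |mgf T ν h - 1 - h * m| := by
      have i1 : Integrable (fun x => Real.exp (h * T x) - 1) ν := ie.sub (integrable_const _)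
      have ir : Integrable (fun x => Real.exp (h * T x) - 1 - h * T x) ν :=
        i1.sub (iT.const_mul h)
      have rn : ∀ x, 0 ≤ Real.exp (h * T x) - 1 - h * T x := fun x => by
        linarith [Real.add_one_le_exp (h * T x)]
      have e1 : ∫ x in {x | t ≤ T x}, Real.exp (h * T x) ∂ν - ν.real {x | t ≤ T x} -
          h * ∫ x in {x | t ≤ T x}, T x ∂ν =
          ∫ x in {x | t ≤ T x}, (Real.exp (h * T x) - 1 - h * T x) ∂ν := by
        rw [integral_sub i1.integrableOn (iT.const_mul h).integrableOn,
          integral_sub ie.integrableOn (integrable_const _), integral_const_mul]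
        simp
      have e2 : mgf T ν h - 1 - h * m = ∫ x, (Real.exp (h * T x) - 1 - h * T x) ∂ν := by
        rw [integral_sub i1 (iT.const_mul h),
          integral_sub ie (integrable_const _), integral_const_mul]
        simp [mgf, hm]
      rw [e1, e2, abs_of_nonneg (integral_nonneg rn), abs_of_nonneg (integral_nonneg rn)]
      exact setIntegral_le_integral ir (ae_of_all _ rn)
    rw [hsplit]
    set N := ∫ x in {x | t ≤ T x}, Real.exp (h * T x) ∂ν
    set D := ∫ x in {x | t ≤ T x}, T x ∂ν
    set G := ν.real {x | t ≤ T x}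
    have key : N / mgf T ν h - G - h * (D - G * m) =
        (mgf T ν h)⁻¹ * (N - G - h * D) + G * ((mgf T ν h)⁻¹ - 1 - h * -m)
          + D * (h * ((mgf T ν h)⁻¹ - 1)) := by
      rw [div_eq_mul_inv]; ring
    rw [key]
    refine (abs_add_le _ _).trans (add_le_add ((abs_add_le _ _).trans (add_le_add ?_ ?_)) ?_)
    · rw [abs_mul]; gcongr
    · rw [abs_mul, abs_of_nonneg hG0]
      exact mul_le_of_le_one_left (abs_nonneg _) hG1
    · rw [abs_mul]; gcongr

/-- The derivative of `Ψ(t, ·)` at the reference parameter is close to half the mean absolute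
deviation when `t` is close to the mean. -/
lemma abs_setIntegral_sub_half_le (hT : Measurable T) (iT : Integrable T ν) (t : ℝ) :
    |∫ x in {x | t ≤ T x}, (T x - ∫ y, T y ∂ν) ∂ν - (∫ x, |T x - ∫ y, T y ∂ν| ∂ν) / 2| ≤
      |t - ∫ y, T y ∂ν| := by
  set m := ∫ y, T y ∂ν with hm
  have hs := measurableSet_le_stat hT t
  have ic : Integrable (fun x => T x - m) ν := iT.sub (integrable_const _)
  have hc : ∫ x, (T x - m) ∂ν = 0 := by
    rw [integral_sub iT (integrable_const _)]; simp [hm]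
  -- As `T - m` has mean zero, half its absolute mean is the mean of its positive part. The two
  -- integrands differ only where `T` lies between `t` and `m`, and there by at most `|t - m|`.
  have e : ∫ x in {x | t ≤ T x}, (T x - m) ∂ν - (∫ x, |T x - m| ∂ν) / 2 =
      ∫ x, (Set.indicator {x | t ≤ T x} (fun x => T x - m) x - (|T x - m| + (T x - m)) / 2) ∂ν := by
    have i1 : Integrable (fun x => (|T x - m| + (T x - m)) / 2) ν := (ic.abs.add ic).div_const 2
    rw [integral_sub (ic.indicator hs) i1, integral_indicator hs,
      integral_div, integral_add ic.abs ic, hc, add_zero]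
  rw [e, ← Real.norm_eq_abs]
  refine (norm_integral_le_of_norm_le_const (C := |t - m|) (ae_of_all _ fun x => ?_)).trans ?_
  · rw [Real.norm_eq_abs]
    by_cases hx : t ≤ T x
    · rw [Set.indicator_of_mem (by exact hx)]
      rcases abs_cases (T x - m) with ⟨h1, _⟩ | ⟨h1, _⟩ <;> rw [h1] <;>
      rcases abs_cases (t - m) with ⟨h2, _⟩ | ⟨h2, _⟩ <;> rw [h2, abs_le] <;>
      constructor <;> linarith
    · rw [Set.indicator_of_notMem (by exact hx)]
      push Not at hx
      rcases abs_cases (T x - m) with ⟨h1, _⟩ | ⟨h1, _⟩ <;> rw [h1] <;>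
      rcases abs_cases (t - m) with ⟨h2, _⟩ | ⟨h2, _⟩ <;> rw [h2, abs_le] <;>
      constructor <;> linarith
  · simp

lemma not_ae_eq_mean_of_variance_pos (hvar : 0 < variance T ν) :
    ¬ ∀ᵐ x ∂ν, T x = ∫ y, T y ∂ν := by
  intro h
  have : variance T ν = 0 := by
    rw [variance_congr (Y := fun _ => ∫ y, T y ∂ν) h]
    simp [variance, evariance]
  exact hvar.ne' this

lemma integral_abs_sub_mean_pos (iT : Integrable T ν) (hvar : 0 < variance T ν) :
    0 < ∫ x, |T x - ∫ y, T y ∂ν| ∂ν := by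
  refine lt_of_le_of_ne (integral_nonneg fun x => abs_nonneg _) fun h => ?_
  have ic : Integrable (fun x => T x - ∫ y, T y ∂ν) ν := iT.sub (integrable_const _)
  rw [eq_comm, integral_eq_zero_iff_of_nonneg (fun x => abs_nonneg _) ic.abs] at h
  refine not_ae_eq_mean_of_variance_pos ν hvar ?_
  filter_upwards [h] with x hx
  exact sub_eq_zero.1 (abs_eq_zero.1 hx)

/-- Thresholds close to the mean give non-degenerate bits. -/
lemma exists_le_prob_mul_one_sub (hT : Measurable T) (iT : Integrable T ν)
    (hvar : 0 < variance T ν) :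
    ∃ δ > 0, ∃ c > 0, ∀ t, |t - ∫ y, T y ∂ν| < δ →
      c ≤ ν.real {x | t ≤ T x} * (1 - ν.real {x | t ≤ T x}) := by
  set m := ∫ y, T y ∂ν with hm
  set J := ∫ x, |T x - m| ∂ν with hJ
  have hJ0 : 0 < J := integral_abs_sub_mean_pos ν iT hvar
  have ic : Integrable (fun x => T x - m) ν := iT.sub (integrable_const _)
  have hc : ∫ x, (T x - m) ∂ν = 0 := by
    rw [integral_sub iT (integrable_const _)]; simp [hm]
  -- The positive and negative parts of `T - m` both have mean `J / 2`, so neither can be almost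
  -- everywhere at most `J / 4`, respectively `J / 8`. If `|t - m| < J / 8`, the threshold lies
  -- between these two levels.
  have hpos : 0 < ν.real {x | m + J / 4 ≤ T x} := by
    refine lt_of_le_of_ne measureReal_nonneg fun h => ?_
    have h' : ν {x | m + J / 4 ≤ T x} = 0 := (measureReal_eq_zero_iff).1 h.symm
    have : ∫ x, (|T x - m| + (T x - m)) / 2 ∂ν ≤ ∫ x, J / 4 ∂ν := by
      refine integral_mono_ae ((ic.abs.add ic).div_const 2) (integrable_const _) ?_
      have hae : ∀ᵐ x ∂ν, ¬ (m + J / 4 ≤ T x) := by rw [ae_iff]; simpa only [not_not] using h'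
      filter_upwards [hae] with x hx
      push Not at hx
      rcases abs_cases (T x - m) with ⟨h1, _⟩ | ⟨h1, _⟩ <;> rw [h1] <;> linarith
    rw [integral_div, integral_add ic.abs ic, hc] at this
    simp at this
    linarith
  have hneg : 0 < ν.real {x | T x < m - J / 8} := by
    refine lt_of_le_of_ne measureReal_nonneg fun h => ?_
    have h' : ν {x | T x < m - J / 8} = 0 := (measureReal_eq_zero_iff).1 h.symm
    have : ∫ x, (|T x - m| - (T x - m)) / 2 ∂ν ≤ ∫ x, J / 8 ∂ν := by
      refine integral_mono_ae ((ic.abs.sub ic).div_const 2) (integrable_const _) ?_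
      have hae : ∀ᵐ x ∂ν, ¬ (T x < m - J / 8) := by rw [ae_iff]; simpa only [not_not] using h'
      filter_upwards [hae] with x hx
      push Not at hx
      rcases abs_cases (T x - m) with ⟨h1, _⟩ | ⟨h1, _⟩ <;> rw [h1] <;> linarith
    rw [integral_div, integral_sub ic.abs ic, hc] at this
    simp at this
    linarith
  refine ⟨J / 8, by positivity, _, mul_pos hpos hneg, fun t ht => ?_⟩
  rw [abs_lt] at ht
  have g1 : ν.real {x | m + J / 4 ≤ T x} ≤ ν.real {x | t ≤ T x} :=
    measureReal_mono fun x hx => by simp only [Set.mem_ofPred_eq] at hx ⊢; linarith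
  have g2 : ν.real {x | T x < m - J / 8} ≤ 1 - ν.real {x | t ≤ T x} := by
    rw [← probReal_compl_eq_one_sub (measurableSet_le_stat hT t)]
    refine measureReal_mono fun x hx => ?_
    simp only [Set.mem_ofPred_eq, Set.mem_compl_iff, not_le] at hx ⊢
    linarith
  gcongr

end Expansion

/-! ### The score is the centered statistic. -/

lemma score_eq (μ : Measure 𝒳) (T : 𝒳 → ℝ) {θ₀ : ℝ}
    (hθ₀ : θ₀ ∈ interior (integrableExpSet T μ)) (x : 𝒳) :
    score μ T θ₀ x = T x - ∫ y, T y ∂(expFamily μ T θ₀) := by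
  rw [expFamily_eq_tilted μ T (interior_subset hθ₀), integral_tilted_mul_self hθ₀, score]
  have h1 : HasDerivAt (fun s => logDensity μ T s x) (T x - deriv (cgf T μ) θ₀) θ₀ := by
    have := ((hasDerivAt_id θ₀).mul_const (T x)).sub
      (analyticAt_cgf hθ₀).differentiableAt.hasDerivAt
    rw [one_mul] at this
    exact this
  exact h1.deriv

lemma l1Information_eq (μ : Measure 𝒳) (T : 𝒳 → ℝ) {θ₀ : ℝ}
    (hθ₀ : θ₀ ∈ interior (integrableExpSet T μ)) :
    l1Information μ T θ₀ =
      ∫ x, |T x - ∫ y, T y ∂(expFamily μ T θ₀)| ∂(expFamily μ T θ₀) := by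
  simp_rw [l1Information, score_eq μ T hθ₀]

end PrivateExpFamily

/-! ### Local inversion of `Ψ(t, ·)`. -/

namespace PrivateExpFamily

variable {𝒳 : Type*} [MeasurableSpace 𝒳]

/-- By monotonicity, missing the level `p` at `a` means missing it everywhere below, so `a` is a
lower bound of the set defining the infimum, while `b` belongs to it. Neither continuity of `Ψ(t,
·)` nor attainment of the infimum is involved. -/
lemma exists_invPsi_eq_coe (μ : Measure 𝒳) [NeZero μ] {T : 𝒳 → ℝ} (hT : Measurable T)
    {Θ : Set ℝ} (hΘ : Θ ⊆ integrableExpSet T μ) {p t a b : ℝ} (ha : a ∈ Θ) (hb : b ∈ Θ)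
    (hap : Psi μ T t a < p) (hbp : p ≤ Psi μ T t b) :
    ∃ θ : ℝ, invPsi μ T Θ p t = θ ∧ a ≤ θ ∧ θ ≤ b := by
  have hub : invPsi μ T Θ p t ≤ b := sInf_le ⟨b, ⟨hb, hbp⟩, rfl⟩
  have hlb : (a : EReal) ≤ invPsi μ T Θ p t := by
    refine le_sInf ?_
    rintro _ ⟨θ, ⟨hθ, hθp⟩, rfl⟩
    rw [EReal.coe_le_coe_iff]
    by_contra! h
    exact (hap.trans_le hθp).not_ge (Psi_mono μ hT t (hΘ hθ) (hΘ ha) h.le)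
  have h1 : invPsi μ T Θ p t ≠ ⊤ := (hub.trans_lt (EReal.coe_lt_top b)).ne
  have h2 : invPsi μ T Θ p t ≠ ⊥ := ((EReal.bot_lt_coe a).trans_le hlb).ne'
  refine ⟨(invPsi μ T Θ p t).toReal, (EReal.coe_toReal h1 h2).symm, ?_, ?_⟩
  · rwa [← EReal.coe_le_coe_iff, EReal.coe_toReal h1 h2]
  · rwa [← EReal.coe_le_coe_iff, EReal.coe_toReal h1 h2]

/-- Linearization of `Ψ(t, ·)` at `θ₀` with slope `J / 2`, uniform over thresholds close to the
mean. -/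
lemma exists_abs_Psi_sub_le (μ : Measure 𝒳) [NeZero μ] {T : 𝒳 → ℝ} (hT : Measurable T)
    {θ₀ : ℝ} (hθ₀ : θ₀ ∈ interior (integrableExpSet T μ)) {η : ℝ} (hη : 0 < η) :
    ∃ ρ > 0, ∀ h, |h| < ρ → ∀ t, |t - ∫ x, T x ∂(expFamily μ T θ₀)| ≤ η →
      |Psi μ T t (θ₀ + h) - Psi μ T t θ₀ - h * (l1Information μ T θ₀ / 2)| ≤ 2 * η * |h| := by
  have hθ₀' := interior_subset hθ₀
  have := isProbabilityMeasure_expFamily μ T hθ₀'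
  have h0 := zero_mem_interior_expFamily μ T hθ₀
  obtain ⟨r, hr, hexp⟩ := exists_isLittleO_Psi_sub (expFamily μ T θ₀) hT h0
  have hev := (hr.bound hη).and (mem_interior_iff_mem_nhds.1 h0)
  obtain ⟨ρ, hρ, hball⟩ := Metric.eventually_nhds_iff.1 hev
  refine ⟨ρ, hρ, fun h hh t ht => ?_⟩
  obtain ⟨hrh, hmem⟩ := hball (y := h) (by simpa using hh)
  have hmem : h ∈ integrableExpSet T (expFamily μ T θ₀) := hmem
  have e1 := hexp t h hmem
  rw [Psi_expFamily μ T t hθ₀' ((integrable_exp_mul_expFamily_iff μ T hθ₀' h).1 hmem)] at e1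
  have e2 := abs_setIntegral_sub_half_le (expFamily μ T θ₀) hT
    (integrable_of_mem_interior_integrableExpSet h0) t
  rw [← l1Information_eq μ T hθ₀] at e2
  change |Psi μ T t (θ₀ + h) - Psi μ T t θ₀ - _| ≤ _ at e1
  set S := ∫ x in {x | t ≤ T x}, (T x - ∫ y, T y ∂(expFamily μ T θ₀)) ∂(expFamily μ T θ₀)
  have hrh' : r h ≤ η * |h| := (le_abs_self _).trans hrh
  -- One `η` pays for the Taylor remainder, the other for replacing the true slope `S` by `J / 2`.
  have key : Psi μ T t (θ₀ + h) - Psi μ T t θ₀ - h * (l1Information μ T θ₀ / 2) =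
      (Psi μ T t (θ₀ + h) - Psi μ T t θ₀ - h * S) + h * (S - l1Information μ T θ₀ / 2) := by ring
  rw [key]
  refine (abs_add_le _ _).trans ?_
  have e3 : |h * (S - l1Information μ T θ₀ / 2)| ≤ |h| * η := by
    rw [abs_mul]
    exact mul_le_mul_of_nonneg_left (e2.trans ht) (abs_nonneg _)
  linarith

/-- The inverse function, evaluated within `K / √n` of `Ψ(t, θ₀)`, is linear up to `ε / √n`. -/
lemma exists_invPsi_expansion (μ : Measure 𝒳) [NeZero μ] {T : 𝒳 → ℝ} (hT : Measurable T)
    {Θ : Set ℝ} (hΘ : Θ ⊆ integrableExpSet T μ) {θ₀ : ℝ} (hθ₀ : θ₀ ∈ interior Θ)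
    (hvar : 0 < variance T (expFamily μ T θ₀)) {ε K : ℝ} (hε : 0 < ε) (hK : 0 ≤ K) :
    ∃ δ > 0, ∀ᶠ n : ℕ in atTop, ∀ t p, |t - ∫ x, T x ∂(expFamily μ T θ₀)| ≤ δ →
      |√(n : ℝ) * (p - Psi μ T t θ₀)| ≤ K → ∃ θ : ℝ, invPsi μ T Θ p t = θ ∧
        |√(n : ℝ) * (θ - θ₀) -
          2 * (l1Information μ T θ₀)⁻¹ * (√(n : ℝ) * (p - Psi μ T t θ₀))| ≤ ε := by
  have hint : θ₀ ∈ interior (integrableExpSet T μ) := interior_mono hΘ hθ₀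
  have := isProbabilityMeasure_expFamily μ T (interior_subset hint)
  have h0 := zero_mem_interior_expFamily μ T hint
  have hJ : 0 < l1Information μ T θ₀ := by
    rw [l1Information_eq μ T hint]
    exact integral_abs_sub_mean_pos _ (integrable_of_mem_interior_integrableExpSet h0) hvar
  set L := l1Information μ T θ₀ / 2 with hL
  have hL0 : 0 < L := by positivity
  -- The bracketing points are `θ₀ + (w ± ε) / √n` with `|w| ≤ K / L`, so `R` bounds the local
  -- parameter. The choice of `η` makes the linearization error `2ηR = εL / 2`, less than the change
  -- `εL` of the linear part over a local step `ε`.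
  set R := K / L + ε with hR
  have hR0 : 0 < R := by positivity
  set η := ε * L / (4 * R) with hη
  have hη0 : 0 < η := by positivity
  have hηR : 2 * η * R < ε * L := by
    have : 2 * η * R = ε * L / 2 := by rw [hη]; field_simp; norm_num
    rw [this]; linarith [mul_pos hε hL0]
  obtain ⟨ρ, hρ, hlin⟩ := exists_abs_Psi_sub_le μ hT hint hη0
  obtain ⟨ρ', hρ', hball⟩ := Metric.mem_nhds_iff.1 (mem_interior_iff_mem_nhds.1 hθ₀)
  refine ⟨η, hη0, ?_⟩
  have hlim : Tendsto (fun n : ℕ => √(n : ℝ)) atTop atTop :=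
    Real.tendsto_sqrt_atTop.comp tendsto_natCast_atTop_atTop
  filter_upwards [hlim.eventually_gt_atTop (R / min ρ ρ')] with n hn t p ht hp
  have hmin : 0 < min ρ ρ' := lt_min hρ hρ'
  have hs : 0 < √(n : ℝ) := (by positivity : 0 < R / min ρ ρ').trans hn
  have hsmall : R / √(n : ℝ) < min ρ ρ' := by
    rw [div_lt_iff₀ hmin] at hn
    rw [div_lt_iff₀ hs]; linarith
  set G := Psi μ T t θ₀
  set s := √(n : ℝ)
  set w := s * (p - G) / L with hw
  have hwL : w * L = s * (p - G) := div_mul_cancel₀ _ hL0.ne'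
  have hwK : |w| ≤ K / L := by
    rw [hw, abs_div, abs_of_pos hL0]; gcongr
  have main : ∀ u : ℝ, |u| ≤ R → θ₀ + u / s ∈ Θ ∧
      |s * (Psi μ T t (θ₀ + u / s) - G) - u * L| ≤ 2 * η * R := by
    intro u hu
    have hus : |u / s| ≤ R / s := by rw [abs_div, abs_of_pos hs]; gcongr
    have hus' := hus.trans_lt hsmall
    refine ⟨hball ?_, ?_⟩
    · rw [Metric.mem_ball, Real.dist_eq, add_sub_cancel_left]
      exact (lt_min_iff.1 hus').2
    · have h1 := hlin (u / s) (lt_min_iff.1 hus').1 t ht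
      have h2 : s * (Psi μ T t (θ₀ + u / s) - G) - u * L =
          s * (Psi μ T t (θ₀ + u / s) - G - u / s * L) := by field_simp
      rw [h2, abs_mul, abs_of_pos hs]
      calc s * |Psi μ T t (θ₀ + u / s) - G - u / s * L| ≤ s * (2 * η * (R / s)) := by
            gcongr; exact h1.trans (by gcongr)
        _ = 2 * η * R := by field_simp
  have hbw := abs_le.1 hwK
  obtain ⟨ma, la⟩ := main (w - ε) (abs_le.2 ⟨by linarith, by linarith⟩)
  obtain ⟨mb, lb⟩ := main (w + ε) (abs_le.2 ⟨by linarith, by linarith⟩)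
  have hap : Psi μ T t (θ₀ + (w - ε) / s) < p := by
    have := (abs_le.1 la).2
    have : s * (Psi μ T t (θ₀ + (w - ε) / s) - G) < s * (p - G) := by
      rw [← hwL]; linarith
    linarith [lt_of_mul_lt_mul_left this hs.le]
  have hbp : p ≤ Psi μ T t (θ₀ + (w + ε) / s) := by
    have := (abs_le.1 lb).1
    have : s * (p - G) < s * (Psi μ T t (θ₀ + (w + ε) / s) - G) := by
      rw [← hwL]; linarith
    linarith [lt_of_mul_lt_mul_left this hs.le]
  obtain ⟨θ, hθ, h1, h2⟩ := exists_invPsi_eq_coe μ hT hΘ ma mb hap hbp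
  refine ⟨θ, hθ, ?_⟩
  have e : 2 * (l1Information μ T θ₀)⁻¹ * (s * (p - G)) = w := by
    rw [hw, hL]; field_simp
  have h1' : w - ε ≤ s * (θ - θ₀) := by
    rw [← div_le_iff₀' hs]; linarith
  have h2' : s * (θ - θ₀) ≤ w + ε := by
    rw [← le_div_iff₀' hs]; linarith
  rw [e, abs_le]
  constructor <;> linarith

end PrivateExpFamily

/-! ### A uniform central limit theorem for characteristic functions. -/

namespace PrivateExpFamily

/-- Telescoping in the unit disc: an error of order `n^(-3/2)` in one factor costs only `n^(-1/2)`
in the `n`-th power. -/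
lemma norm_pow_sub_pow_le_mul {z w : ℂ} (hz : ‖z‖ ≤ 1) (hw : ‖w‖ ≤ 1) (n : ℕ) :
    ‖z ^ n - w ^ n‖ ≤ n * ‖z - w‖ := by
  induction n with
  | zero => simp
  | succ n ih =>
    have e : z ^ (n + 1) - w ^ (n + 1) = (z ^ n - w ^ n) * z + w ^ n * (z - w) := by ring
    rw [e]
    refine (norm_add_le _ _).trans ?_
    rw [norm_mul, norm_mul, norm_pow]
    have h1 : ‖z ^ n - w ^ n‖ * ‖z‖ ≤ n * ‖z - w‖ :=
      (mul_le_of_le_one_right (norm_nonneg _) hz).trans ih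
    have h2 : ‖w‖ ^ n * ‖z - w‖ ≤ ‖z - w‖ :=
      mul_le_of_le_one_left (norm_nonneg _) (pow_le_one₀ (norm_nonneg _) hw)
    push_cast
    linarith

section Taylor

variable {S : Type*} [MeasurableSpace S] (ρ : Measure S) [IsProbabilityMeasure ρ]

/-- Second-order expansion of the characteristic function of a bounded centered variable. -/
lemma norm_integral_cexp_sub_le {Y : S → ℝ} (hY : Measurable Y) {C s r : ℝ}
    (hC : ∀ z, |Y z| ≤ C) (h0 : ∫ z, Y z ∂ρ = 0) (h2 : ∫ z, Y z ^ 2 ∂ρ = s)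
    (hr0 : 0 ≤ r) (hr1 : r ≤ 1) :
    ‖∫ z, Complex.exp ((r * Y z : ℝ) * Complex.I) ∂ρ - ((1 - r ^ 2 * s / 2 : ℝ) : ℂ)‖ ≤
      r ^ 3 * (C ^ 3 * Real.exp C) := by
  have iY : Integrable Y ρ := .of_bound hY.aestronglyMeasurable C (ae_of_all _ hC)
  have iY2 : Integrable (fun z => Y z ^ 2) ρ :=
    .of_bound (by fun_prop) (C ^ 2) (ae_of_all _ fun z => by
      rw [Real.norm_eq_abs, abs_pow]; exact pow_le_pow_left₀ (abs_nonneg _) (hC z) 2)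
  have ie : Integrable (fun z => Complex.exp ((r * Y z : ℝ) * Complex.I)) ρ :=
    .of_bound (by fun_prop) 1 (ae_of_all _ fun z => by rw [Complex.norm_exp_ofReal_mul_I])
  have ip1 : Integrable (fun z => (1 : ℂ) + ((r * Y z : ℝ) : ℂ) * Complex.I) ρ :=
    (integrable_const _).add (((iY.const_mul r).ofReal).mul_const _)
  have ip2 : Integrable (fun z => ((r ^ 2 / 2 * Y z ^ 2 : ℝ) : ℂ)) ρ := (iY2.const_mul _).ofReal
  have e : ((1 - r ^ 2 * s / 2 : ℝ) : ℂ) =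
      ∫ z, ((1 : ℂ) + ((r * Y z : ℝ) : ℂ) * Complex.I - ((r ^ 2 / 2 * Y z ^ 2 : ℝ) : ℂ)) ∂ρ := by
    rw [integral_sub ip1 ip2, integral_add (integrable_const _)
      (((iY.const_mul r).ofReal).mul_const _), integral_mul_const,
      integral_complex_ofReal, integral_complex_ofReal, integral_const_mul, integral_const_mul,
      h0, h2]
    simp
    ring
  have ip : Integrable (fun z => (1 : ℂ) + ((r * Y z : ℝ) : ℂ) * Complex.I -
      ((r ^ 2 / 2 * Y z ^ 2 : ℝ) : ℂ)) ρ := ip1.sub ip2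
  rw [e, ← integral_sub ie ip]
  refine (norm_integral_le_of_norm_le_const (C := r ^ 3 * (C ^ 3 * Real.exp C))
    (ae_of_all _ fun z => ?_)).trans (by simp)
  -- The Taylor remainder of order three depends on `Y` only through `|Y| ≤ C`, which gives
  -- uniformity over `Y`.
  have hx := Complex.norm_exp_sub_sum_le_norm_mul_exp ((r * Y z : ℝ) * Complex.I) 3
  have hn : ‖((r * Y z : ℝ) : ℂ) * Complex.I‖ = r * |Y z| := by
    rw [norm_mul, Complex.norm_I, mul_one, Complex.norm_real, Real.norm_eq_abs, abs_mul,
      abs_of_nonneg hr0]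
  rw [hn] at hx
  have hsum : ∑ m ∈ Finset.range 3, (((r * Y z : ℝ) : ℂ) * Complex.I) ^ m / (m.factorial : ℂ) =
      (1 : ℂ) + ((r * Y z : ℝ) : ℂ) * Complex.I - ((r ^ 2 / 2 * Y z ^ 2 : ℝ) : ℂ) := by
    simp [Finset.sum_range_succ, mul_pow, Nat.factorial]
    ring
  rw [hsum] at hx
  refine hx.trans ?_
  have hC0 : 0 ≤ C := (abs_nonneg _).trans (hC z)
  rw [mul_pow, mul_assoc]
  have : r * |Y z| ≤ C := (mul_le_of_le_one_left (abs_nonneg _) hr1).trans (hC z)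
  gcongr
  exact hC z

/-- The central limit theorem for characteristic functions, uniform over bounded centered variables
of given variance. -/
lemma eventually_norm_integral_cexp_pow_sub_le (C s : ℝ) {ε : ℝ} (hε : 0 < ε) :
    ∀ᶠ n : ℕ in atTop, ∀ Y : S → ℝ, Measurable Y → (∀ z, |Y z| ≤ C) → ∫ z, Y z ∂ρ = 0 →
      ∫ z, Y z ^ 2 ∂ρ = s →
      ‖(∫ z, Complex.exp (((√(n : ℝ))⁻¹ * Y z : ℝ) * Complex.I) ∂ρ) ^ n -
        Complex.exp (-s / 2 : ℝ)‖ ≤ ε := by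
  have hsq : Tendsto (fun n : ℕ => (√(n : ℝ))⁻¹) atTop (𝓝 0) :=
    tendsto_inv_atTop_zero.comp (Real.tendsto_sqrt_atTop.comp tendsto_natCast_atTop_atTop)
  have l1 : Tendsto (fun n : ℕ => (√(n : ℝ))⁻¹ * (C ^ 3 * Real.exp C)) atTop (𝓝 0) := by
    simpa using hsq.mul_const (C ^ 3 * Real.exp C)
  have l2 : Tendsto (fun n : ℕ => (1 + ((-s / 2 : ℝ) : ℂ) / n) ^ n) atTop
      (𝓝 (Complex.exp (-s / 2 : ℝ))) := Complex.tendsto_one_add_div_pow_exp _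
  have l2' := Metric.tendsto_atTop'.1 l2 (ε / 2) (by positivity)
  obtain ⟨N, hN⟩ := l2'
  -- `n ≥ ⌈s⌉₊` keeps `1 - s / (2n)` in the unit disc, as the telescoping bound requires.
  filter_upwards [l1.eventually_lt_const (by positivity : (0 : ℝ) < ε / 2), eventually_gt_atTop N,
    eventually_ge_atTop 1, eventually_ge_atTop ⌈s⌉₊] with n h1 h2 hn hs Y hY hC h0 hv
  have hn' : (1 : ℝ) ≤ n := by exact_mod_cast hn
  have hs' : s ≤ n := (Nat.le_ceil s).trans (by exact_mod_cast hs)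
  have hs0 : 0 ≤ s := by rw [← hv]; exact integral_nonneg fun z => sq_nonneg _
  have hsn : (√(n : ℝ)) ^ 2 = n := Real.sq_sqrt (by positivity)
  have hsp : 1 ≤ √(n : ℝ) := by rw [Real.one_le_sqrt]; exact hn'
  have hT := norm_integral_cexp_sub_le ρ hY hC h0 hv (r := (√(n : ℝ))⁻¹) (by positivity)
    (inv_le_one_of_one_le₀ hsp)
  rw [inv_pow, hsn] at hT
  set z := ∫ z, Complex.exp (((√(n : ℝ))⁻¹ * Y z : ℝ) * Complex.I) ∂ρ with hz
  have hz1 : ‖z‖ ≤ 1 := by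
    refine (norm_integral_le_of_norm_le_const (C := 1) (ae_of_all _ fun x => ?_)).trans (by simp)
    rw [Complex.norm_exp_ofReal_mul_I]
  have hw1 : ‖((1 - (n : ℝ)⁻¹ * s / 2 : ℝ) : ℂ)‖ ≤ 1 := by
    rw [Complex.norm_real, Real.norm_eq_abs, abs_le]
    have : (n : ℝ)⁻¹ * s ≤ 1 := by rw [inv_mul_le_iff₀ (by positivity)]; linarith
    have : 0 ≤ (n : ℝ)⁻¹ * s := by positivity
    constructor <;> linarith
  have hp := norm_pow_sub_pow_le_mul hz1 hw1 n
  have hq : (n : ℝ) * ‖z - ((1 - (n : ℝ)⁻¹ * s / 2 : ℝ) : ℂ)‖ ≤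
      (√(n : ℝ))⁻¹ * (C ^ 3 * Real.exp C) := by
    calc (n : ℝ) * ‖z - ((1 - (n : ℝ)⁻¹ * s / 2 : ℝ) : ℂ)‖ ≤
          n * (((√(n : ℝ))⁻¹) ^ 3 * (C ^ 3 * Real.exp C)) := by gcongr
      _ = (√(n : ℝ))⁻¹ * (C ^ 3 * Real.exp C) := by
          nth_rw 1 [← hsn]; field_simp
  have h3 := h2 |> hN n
  rw [dist_eq_norm] at h3
  have e : (1 + ((-s / 2 : ℝ) : ℂ) / n) = ((1 - (n : ℝ)⁻¹ * s / 2 : ℝ) : ℂ) := by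
    push_cast; ring
  rw [e] at h3
  calc ‖z ^ n - Complex.exp (-s / 2 : ℝ)‖ ≤ ‖z ^ n - ((1 - (n : ℝ)⁻¹ * s / 2 : ℝ) : ℂ) ^ n‖ +
        ‖((1 - (n : ℝ)⁻¹ * s / 2 : ℝ) : ℂ) ^ n - Complex.exp (-s / 2 : ℝ)‖ := by
          exact norm_sub_le_norm_sub_add_norm_sub _ _ _
    _ ≤ ε := by linarith

end Taylor

/-! ### Averaging over an independent random threshold. -/

section Mixing

variable {Ω : Type*} [MeasurableSpace Ω] (P : Measure Ω) [IsProbabilityMeasure P]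

/-- Averages of uniformly bounded functions `φ n`, converging uniformly near `m`, along random
points converging to `m` in probability. -/
lemma tendsto_integral_comp_of_tendstoInMeasure {τ : ℕ → Ω → ℝ} (hτ : ∀ n, Measurable (τ n))
    {m : ℝ} (hm : TendstoInMeasure P τ atTop (fun _ => m)) {φ : ℕ → ℝ → ℂ}
    (hφ : ∀ n, Measurable (φ n)) (hφ1 : ∀ n t, ‖φ n t‖ ≤ 1) {L : ℂ} (hL : ‖L‖ ≤ 1) {δ : ℝ}
    (hδ : 0 < δ) (hlim : ∀ ε > 0, ∀ᶠ n in atTop, ∀ t, |t - m| < δ → ‖φ n t - L‖ ≤ ε) :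
    Tendsto (fun n => ∫ ω, φ n (τ n ω) ∂P) atTop (𝓝 L) := by
  rw [Metric.tendsto_atTop']
  intro ε hε
  have hm' := (tendstoInMeasure_iff_measureReal_dist.1 hm) δ hδ
  -- Away from `m` only the trivial bound `2` is available, so the exceptional probability is taken
  -- below `ε / 4`.
  obtain ⟨N, hN⟩ := eventually_atTop.1 ((hlim (ε / 2) (by positivity)).and
    (hm'.eventually_lt_const (by positivity : (0 : ℝ) < ε / 4)))
  refine ⟨N, fun n hn => ?_⟩
  obtain ⟨h1, h2⟩ := hN n hn.le
  have hmeas : MeasurableSet {ω | δ ≤ dist (τ n ω) m} :=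
    measurableSet_le measurable_const ((hτ n).dist measurable_const)
  have iφ : Integrable (fun ω => φ n (τ n ω)) P :=
    .of_bound ((hφ n).comp (hτ n)).aestronglyMeasurable 1 (ae_of_all _ fun ω => hφ1 n _)
  have e : ∫ ω, φ n (τ n ω) ∂P - L = ∫ ω, (φ n (τ n ω) - L) ∂P := by
    rw [integral_sub iφ (integrable_const _)]; simp
  rw [dist_eq_norm, e]
  have i1 : Integrable (fun ω => 2 * Set.indicator {ω | δ ≤ dist (τ n ω) m} (1 : Ω → ℝ) ω) P :=
    ((integrable_const (1 : ℝ)).indicator hmeas).const_mul 2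
  have i2 : Integrable (fun ω => ε / 2 + 2 * Set.indicator {ω | δ ≤ dist (τ n ω) m} 1 ω) P :=
    (integrable_const _).add i1
  calc ‖∫ ω, (φ n (τ n ω) - L) ∂P‖ ≤
        ∫ ω, (ε / 2 + 2 * Set.indicator {ω | δ ≤ dist (τ n ω) m} 1 ω) ∂P := by
        refine norm_integral_le_of_norm_le i2 (ae_of_all _ fun ω => ?_)
        by_cases hω : δ ≤ dist (τ n ω) m
        · rw [Set.indicator_of_mem (by exact hω)]
          have := norm_sub_le (φ n (τ n ω)) L
          have := hφ1 n (τ n ω)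
          simp only [Pi.one_apply]
          linarith
        · rw [Set.indicator_of_notMem (by exact hω)]
          have := h1 (τ n ω) (by rw [← Real.dist_eq]; exact not_le.1 hω)
          linarith
    _ = ε / 2 + 2 * P.real {ω | δ ≤ dist (τ n ω) m} := by
        rw [integral_add (integrable_const _) i1, integral_const_mul,
          integral_indicator_one hmeas]
        simp
    _ < ε := by linarith

/-- A joint characteristic function conditionally on an independent parameter. -/
lemma integral_cexp_sum_eq {S : Type*} [MeasurableSpace S] {ρ : Measure S}
    [IsProbabilityMeasure ρ] {n : ℕ} {τ : Ω → ℝ} (hτ : Measurable τ) {Z : Fin n → Ω → S}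
    (hZ : ∀ i, Measurable (Z i)) (hlaw : ∀ i, P.map (Z i) = ρ) (hind : iIndepFun Z P)
    (hτZ : IndepFun τ (fun ω i => Z i ω) P) {Y : ℝ → S → ℝ}
    (hY : Measurable (Function.uncurry Y)) (r : ℝ) :
    ∫ ω, Complex.exp ((r * ∑ i, Y (τ ω) (Z i ω) : ℝ) * Complex.I) ∂P =
      ∫ ω, (∫ z, Complex.exp ((r * Y (τ ω) z : ℝ) * Complex.I) ∂ρ) ^ n ∂P := by
  have hZ' : Measurable (fun ω i => Z i ω) := measurable_pi_lambda _ hZ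
  have hmap : P.map (fun ω => (τ ω, fun i => Z i ω)) =
      (P.map τ).prod (Measure.pi fun _ : Fin n => ρ) := by
    rw [(indepFun_iff_map_prod_eq_prod_map_map hτ.aemeasurable hZ'.aemeasurable).1 hτZ,
      (iIndepFun_iff_map_fun_eq_pi_map fun i => (hZ i).aemeasurable).1 hind]
    simp_rw [hlaw]
  have := Measure.isProbabilityMeasure_map (μ := P) hτ.aemeasurable
  have hYi : ∀ i, Measurable fun p : ℝ × (Fin n → S) => Y p.1 (p.2 i) := fun i =>
    hY.comp (measurable_fst.prodMk ((measurable_pi_apply i).comp measurable_snd))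
  have hF : Measurable fun p : ℝ × (Fin n → S) =>
      Complex.exp ((r * ∑ i, Y p.1 (p.2 i) : ℝ) * Complex.I) := by
    have : Measurable fun p : ℝ × (Fin n → S) => ∑ i, Y p.1 (p.2 i) :=
      Finset.measurable_fun_sum _ fun i _ => hYi i
    fun_prop
  have hG : Measurable fun t : ℝ => (∫ z, Complex.exp ((r * Y t z : ℝ) * Complex.I) ∂ρ) ^ n := by
    have h1 : Measurable fun p : ℝ × S => Y p.1 p.2 := hY
    have : StronglyMeasurable fun p : ℝ × S =>
        Complex.exp ((r * Y p.1 p.2 : ℝ) * Complex.I) := by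
      refine Measurable.stronglyMeasurable ?_
      fun_prop
    exact (this.integral_prod_right').measurable.pow_const n
  have e1 : ∫ ω, Complex.exp ((r * ∑ i, Y (τ ω) (Z i ω) : ℝ) * Complex.I) ∂P =
      ∫ p, Complex.exp ((r * ∑ i, Y p.1 (p.2 i) : ℝ) * Complex.I)
        ∂(P.map (fun ω => (τ ω, fun i => Z i ω))) := by
    rw [integral_map (hτ.prodMk hZ').aemeasurable hF.aestronglyMeasurable]
  -- Under the product law the threshold is frozen at `t`, and the inner integral factors over the
  -- sample.
  rw [e1, hmap, integral_prod]
  · rw [← integral_map (φ := τ)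
      (f := fun t => (∫ z, Complex.exp ((r * Y t z : ℝ) * Complex.I) ∂ρ) ^ n)
      hτ.aemeasurable hG.aestronglyMeasurable]
    congr 1
    ext t
    have e2 : ∀ z : Fin n → S, Complex.exp ((r * ∑ i, Y t (z i) : ℝ) * Complex.I) =
        ∏ i, Complex.exp ((r * Y t (z i) : ℝ) * Complex.I) := fun z => by
      rw [← Complex.exp_sum, Finset.mul_sum, Complex.ofReal_sum, Finset.sum_mul]
    simp_rw [e2]
    rw [integral_fintype_prod_eq_pow (fun z => Complex.exp ((r * Y t z : ℝ) * Complex.I)),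
      Fintype.card_fin]
  · exact .of_bound hF.aestronglyMeasurable 1 (ae_of_all _ fun p => by
      rw [Complex.norm_exp_ofReal_mul_I])

end Mixing

/-! ### Randomized response: privacy and moments. -/

lemma threshold_eq_zero_or_one {𝒳 : Type*} (T : 𝒳 → ℝ) (t : ℝ) (x : 𝒳) :
    threshold T t x = 0 ∨ threshold T t x = 1 := by
  unfold threshold; split_ifs <;> simp

section Coin

variable {α : ℝ}

/-- Flipping the bit amounts to flipping the coin. Privacy thus reduces to comparing the coin law
with its image under negation. -/
lemma response_one_sub (α v : ℝ) (b : Bool) : response α (1 - v) b = response α v (!b) := by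
  cases b <;> simp [response]

lemma isProbabilityMeasure_coinLaw (α : ℝ) : IsProbabilityMeasure (coinLaw α) := by
  constructor
  have he := Real.exp_pos α
  simp only [coinLaw, Measure.coe_add, Measure.coe_smul, Pi.add_apply, Pi.smul_apply,
    measure_univ, smul_eq_mul, mul_one]
  rw [← ENNReal.ofReal_add (by positivity) (by positivity), ← add_div, div_self (by positivity),
    ENNReal.ofReal_one]

lemma coinLaw_apply (α : ℝ) (S : Set Bool) : coinLaw α S =
    ENNReal.ofReal (Real.exp α / (Real.exp α + 1)) * S.indicator 1 true +
      ENNReal.ofReal (1 / (Real.exp α + 1)) * S.indicator 1 false := by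
  simp [coinLaw]

lemma coinLaw_preimage_not_le (hα : 0 ≤ α) (S : Set Bool) :
    coinLaw α S ≤ ENNReal.ofReal (Real.exp α) * coinLaw α ((fun b => !b) ⁻¹' S) := by
  have he := Real.exp_pos α
  have h1 : 1 ≤ Real.exp α := Real.one_le_exp hα
  have e1 : ENNReal.ofReal (Real.exp α / (Real.exp α + 1)) =
      ENNReal.ofReal (Real.exp α) * ENNReal.ofReal (1 / (Real.exp α + 1)) := by
    rw [← ENNReal.ofReal_mul he.le]; congr 1; ring
  have e2 : ENNReal.ofReal (1 / (Real.exp α + 1)) ≤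
      ENNReal.ofReal (Real.exp α) * ENNReal.ofReal (Real.exp α / (Real.exp α + 1)) := by
    rw [← ENNReal.ofReal_mul he.le]
    refine ENNReal.ofReal_le_ofReal ?_
    rw [mul_div_assoc']
    gcongr
    nlinarith
  have i1 : ((fun b => !b) ⁻¹' S).indicator (1 : Bool → ENNReal) true = S.indicator 1 false := rfl
  have i2 : ((fun b => !b) ⁻¹' S).indicator (1 : Bool → ENNReal) false = S.indicator 1 true := rfl
  rw [coinLaw_apply, coinLaw_apply, i1, i2, mul_add, add_comm, ← mul_assoc, ← mul_assoc, ← e1]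
  gcongr

lemma isLocallyDP_channel {𝒳 : Type*} (hα : 0 ≤ α) (T : 𝒳 → ℝ) (t : ℝ) :
    IsLocallyDP α (channel α T t) := by
  intro x x' A hA
  have hm : ∀ v, Measurable (response α v) := fun v => measurable_of_countable _
  rw [channel, channel, Measure.map_apply (hm _) hA, Measure.map_apply (hm _) hA]
  by_cases h : threshold T t x = threshold T t x'
  · rw [h]
    exact le_mul_of_one_le_left zero_le (by simpa using hα)
  · have h' : threshold T t x' = 1 - threshold T t x := by
      rcases threshold_eq_zero_or_one T t x with h1 | h1 <;>
      rcases threshold_eq_zero_or_one T t x' with h2 | h2 <;> simp_all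
    rw [h', show response α (1 - threshold T t x) =
      response α (threshold T t x) ∘ fun b => !b from funext (response_one_sub _ _),
      Set.preimage_comp]
    exact coinLaw_preimage_not_le hα _

lemma integral_coinLaw (α : ℝ) (f : Bool → ℝ) : ∫ b, f b ∂(coinLaw α) =
    Real.exp α / (Real.exp α + 1) * f true + 1 / (Real.exp α + 1) * f false := by
  have he := Real.exp_pos α
  have hi : ∀ b : Bool, Integrable f (Measure.dirac b) := fun b => Integrable.of_finite
  rw [coinLaw, integral_add_measure ((hi _).smul_measure ENNReal.ofReal_ne_top)
    ((hi _).smul_measure ENNReal.ofReal_ne_top), integral_smul_measure, integral_smul_measure,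
    integral_dirac, integral_dirac, ENNReal.toReal_ofReal (by positivity),
    ENNReal.toReal_ofReal (by positivity)]
  rfl

lemma integral_response_sub (hα : 0 < α) (v : ℝ) :
    ∫ b, (response α v b - v) ∂(coinLaw α) = 0 := by
  have h1 : 0 < Real.exp α - 1 := sub_pos.2 (Real.one_lt_exp_iff.2 hα)
  have h2 : 0 < Real.exp α + 1 := by positivity
  rw [integral_coinLaw]
  simp only [response, if_true, Bool.false_eq_true, if_false]
  field_simp
  ring

/-- Changing the bit only reverses the sign of the error `response - v`, so its variance is the same
for both bits. This keeps the limit law of `E₁` free of the threshold. -/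
lemma integral_response_sub_sq (hα : 0 < α) {v : ℝ} (hv : v = 0 ∨ v = 1) :
    ∫ b, (response α v b - v) ^ 2 ∂(coinLaw α) = deltaSq α := by
  have h1 : 0 < Real.exp α - 1 := sub_pos.2 (Real.one_lt_exp_iff.2 hα)
  have h2 : 0 < Real.exp α + 1 := by positivity
  rw [integral_coinLaw, deltaSq]
  rcases hv with rfl | rfl <;>
  simp only [response, if_true, Bool.false_eq_true, if_false] <;> field_simp <;> ring

lemma abs_response_sub_le (hα : 0 < α) {v : ℝ} (hv : v = 0 ∨ v = 1) (b : Bool) :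
    |response α v b - v| ≤ (Real.exp α + 1) / (Real.exp α - 1) + 1 := by
  have h1 : 0 < Real.exp α - 1 := sub_pos.2 (Real.one_lt_exp_iff.2 hα)
  have h2 : 0 < Real.exp α + 1 := by positivity
  have h3 : 1 / (Real.exp α + 1) ≤ 1 := by
    rw [div_le_one h2]; linarith [Real.exp_pos α]
  have h4 : 0 < 1 / (Real.exp α + 1) := by positivity
  refine (abs_sub _ _).trans (add_le_add ?_ ?_)
  · rw [response, abs_mul, abs_of_pos (by positivity)]
    refine mul_le_of_le_one_right (by positivity) ?_
    rcases hv with rfl | rfl <;> cases b <;> simp only [if_true, Bool.false_eq_true, if_false] <;>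
      rw [abs_le] <;> constructor <;> linarith
  · rcases hv with rfl | rfl <;> simp

lemma measurable_response (α : ℝ) : Measurable fun p : ℝ × Bool => response α p.1 p.2 := by
  unfold response
  have h : MeasurableSet {p : ℝ × Bool | p.2 = true} :=
    measurable_snd (measurableSet_singleton true)
  have : Measurable fun p : ℝ × Bool => if p.2 = true then p.1 else 1 - p.1 :=
    Measurable.ite h measurable_fst (measurable_const.sub measurable_fst)
  fun_prop

end Coin

end PrivateExpFamily

/-! ### Moments of a single report. -/

namespace PrivateExpFamily

variable {𝒳 : Type*} [MeasurableSpace 𝒳]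

lemma measurable_threshold {T : 𝒳 → ℝ} (hT : Measurable T) :
    Measurable fun p : ℝ × 𝒳 => threshold T p.1 p.2 := by
  unfold threshold
  exact Measurable.ite (measurableSet_le measurable_fst (hT.comp measurable_snd))
    measurable_const measurable_const

lemma integral_threshold (ν : Measure 𝒳) {T : 𝒳 → ℝ} (hT : Measurable T) (t : ℝ) :
    ∫ x, threshold T t x ∂ν = ν.real {x | t ≤ T x} := by
  rw [← integral_indicator_one (measurableSet_le_stat hT t)]
  rfl

lemma measurable_measureReal_le (ν : Measure 𝒳) [IsFiniteMeasure ν] (T : 𝒳 → ℝ) :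
    Measurable fun t : ℝ => ν.real {x | t ≤ T x} := by
  refine Antitone.measurable fun a b hab => measureReal_mono fun x hx => ?_
  simp only [Set.mem_ofPred_eq] at hx ⊢
  linarith

/-- Standard deviation of the bit `1{T(x) ≥ t}` under `ν`. -/
noncomputable def bitDev (ν : Measure 𝒳) (T : 𝒳 → ℝ) (t : ℝ) : ℝ :=
  √(ν.real {x | t ≤ T x} * (1 - ν.real {x | t ≤ T x}))

/-- A linear combination of the privacy noise in one report and of the standardized bit. -/
noncomputable def noiseCombination (ν : Measure 𝒳) (T : 𝒳 → ℝ) (α a b t : ℝ) (z : 𝒳 × Bool) : ℝ :=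
  a * (response α (threshold T t z.1) z.2 - threshold T t z.1) +
    b * ((threshold T t z.1 - ν.real {x | t ≤ T x}) / bitDev ν T t)

lemma integral_coinLaw_noiseCombination (ν : Measure 𝒳) {T : 𝒳 → ℝ} {α : ℝ} (hα : 0 < α)
    (a b t : ℝ) (x : 𝒳) :
    ∫ c, noiseCombination ν T α a b t (x, c) ∂(coinLaw α) =
      b * ((threshold T t x - ν.real {x | t ≤ T x}) / bitDev ν T t) := by
  have := isProbabilityMeasure_coinLaw α
  simp only [noiseCombination]
  rw [integral_add Integrable.of_finite (integrable_const _), integral_const_mul,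
    integral_response_sub hα, integral_const, probReal_univ]
  simp

/-- Given the observation the coin noise has mean zero, so the cross term vanishes. This is the
origin of the diagonal covariance, although the noise itself depends on the bit. -/
lemma integral_coinLaw_noiseCombination_sq (ν : Measure 𝒳) {T : 𝒳 → ℝ} {α : ℝ} (hα : 0 < α)
    (a b t : ℝ) (x : 𝒳) :
    ∫ c, noiseCombination ν T α a b t (x, c) ^ 2 ∂(coinLaw α) =
      a ^ 2 * deltaSq α + b ^ 2 / bitDev ν T t ^ 2 *
        (threshold T t x - ν.real {x | t ≤ T x}) ^ 2 := by
  have := isProbabilityMeasure_coinLaw α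
  set u := b * ((threshold T t x - ν.real {x | t ≤ T x}) / bitDev ν T t) with hu
  have e : ∀ c, noiseCombination ν T α a b t (x, c) ^ 2 =
      a ^ 2 * (response α (threshold T t x) c - threshold T t x) ^ 2 +
        2 * a * u * (response α (threshold T t x) c - threshold T t x) + u ^ 2 := fun c => by
    simp only [noiseCombination, ← hu]; ring
  simp_rw [e]
  rw [integral_add Integrable.of_finite (integrable_const _),
    integral_add Integrable.of_finite Integrable.of_finite, integral_const_mul, integral_const_mul,
    integral_response_sub hα, integral_response_sub_sq hα (threshold_eq_zero_or_one T t x),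
    integral_const, probReal_univ, hu, smul_eq_mul]
  ring

section Moments

variable (ν : Measure 𝒳) [IsProbabilityMeasure ν] {T : 𝒳 → ℝ} {α : ℝ}

lemma measurable_noiseCombination (hT : Measurable T) (α a b : ℝ) :
    Measurable (Function.uncurry (noiseCombination ν T α a b)) := by
  have h1 : Measurable fun p : ℝ × 𝒳 × Bool => threshold T p.1 p.2.1 :=
    (measurable_threshold hT).comp (measurable_fst.prodMk measurable_snd.fst)
  have h2 : Measurable fun p : ℝ × 𝒳 × Bool => response α (threshold T p.1 p.2.1) p.2.2 :=
    (measurable_response α).comp (h1.prodMk measurable_snd.snd)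
  have h3 : Measurable fun p : ℝ × 𝒳 × Bool => ν.real {x | p.1 ≤ T x} :=
    (measurable_measureReal_le ν T).comp measurable_fst
  exact ((h2.sub h1).const_mul a).add
    (((h1.sub h3).div (h3.mul (h3.const_sub 1)).sqrt).const_mul b)

lemma measurable_noiseCombination_right (hT : Measurable T) (α a b t : ℝ) :
    Measurable (noiseCombination ν T α a b t) :=
  (measurable_noiseCombination ν hT α a b).comp measurable_prodMk_left

lemma abs_noiseCombination_le (hα : 0 < α) (a b : ℝ) {c t : ℝ} (hc : 0 < c)
    (hct : c ≤ bitDev ν T t) (z : 𝒳 × Bool) :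
    |noiseCombination ν T α a b t z| ≤
      |a| * ((Real.exp α + 1) / (Real.exp α - 1) + 1) + |b| * c⁻¹ := by
  have hg0 : 0 ≤ ν.real {x | t ≤ T x} := measureReal_nonneg
  have hg1 : ν.real {x | t ≤ T x} ≤ 1 := measureReal_le_one
  have hv := threshold_eq_zero_or_one T t z.1
  refine (abs_add_le _ _).trans ?_
  rw [abs_mul, abs_mul, abs_div, abs_of_pos (hc.trans_le hct)]
  have h1 : |threshold T t z.1 - ν.real {x | t ≤ T x}| ≤ 1 := by
    rcases hv with h | h <;> rw [h, abs_le] <;> constructor <;> linarith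
  have h2 : |threshold T t z.1 - ν.real {x | t ≤ T x}| / bitDev ν T t ≤ c⁻¹ := by
    rw [← one_div]; gcongr
  have := abs_response_sub_le hα hv z.2
  gcongr

lemma integral_prod_coinLaw_eq {f : 𝒳 × Bool → ℝ} (hf : Measurable f) {C : ℝ}
    (hC : ∀ z, |f z| ≤ C) :
    ∫ z, f z ∂(ν.prod (coinLaw α)) = ∫ x, ∫ b, f (x, b) ∂(coinLaw α) ∂ν := by
  have := isProbabilityMeasure_coinLaw α
  exact integral_prod _ (.of_bound hf.aestronglyMeasurable C (ae_of_all _ hC))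

lemma integral_threshold_sub (hT : Measurable T) (t : ℝ) :
    ∫ x, (threshold T t x - ν.real {x | t ≤ T x}) ∂ν = 0 := by
  have iV : Integrable (threshold T t) ν :=
    .of_bound ((measurable_threshold hT).comp measurable_prodMk_left).aestronglyMeasurable 1
      (ae_of_all _ fun x => by
        rcases threshold_eq_zero_or_one T t x with h | h <;> simp [h])
  rw [integral_sub iV (integrable_const _), integral_threshold ν hT]
  simp

lemma integral_threshold_sub_sq (hT : Measurable T) (t : ℝ) :
    ∫ x, (threshold T t x - ν.real {x | t ≤ T x}) ^ 2 ∂ν =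
      ν.real {x | t ≤ T x} * (1 - ν.real {x | t ≤ T x}) := by
  set g := ν.real {x | t ≤ T x} with hg
  have iV : Integrable (fun x => threshold T t x) ν :=
    .of_bound ((measurable_threshold hT).comp measurable_prodMk_left).aestronglyMeasurable 1
      (ae_of_all _ fun x => by
        rcases threshold_eq_zero_or_one T t x with h | h <;> simp [h])
  have e : ∀ x, (threshold T t x - g) ^ 2 = (1 - 2 * g) * threshold T t x + g ^ 2 := fun x => by
    rcases threshold_eq_zero_or_one T t x with h | h <;> rw [h] <;> ring
  simp_rw [e]
  rw [integral_add (iV.const_mul _) (integrable_const _), integral_const_mul,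
    integral_threshold ν hT, ← hg]
  simp
  ring

lemma integral_noiseCombination (hT : Measurable T) (hα : 0 < α) (a b : ℝ) {t : ℝ}
    (ht : 0 < bitDev ν T t) :
    ∫ z, noiseCombination ν T α a b t z ∂(ν.prod (coinLaw α)) = 0 := by
  rw [integral_prod_coinLaw_eq ν (measurable_noiseCombination_right ν hT α a b t)
    (abs_noiseCombination_le ν hα a b ht le_rfl)]
  simp_rw [integral_coinLaw_noiseCombination ν hα]
  rw [integral_const_mul, integral_div, integral_threshold_sub ν hT]
  simp

lemma integral_noiseCombination_sq (hT : Measurable T) (hα : 0 < α) (a b : ℝ) {t : ℝ}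
    (ht : 0 < bitDev ν T t) :
    ∫ z, noiseCombination ν T α a b t z ^ 2 ∂(ν.prod (coinLaw α)) =
      a ^ 2 * deltaSq α + b ^ 2 := by
  have hb := abs_noiseCombination_le ν hα a b ht le_rfl
  have iV : Integrable (fun x => (threshold T t x - ν.real {x | t ≤ T x}) ^ 2) ν := by
    have h1 : Measurable fun x => threshold T t x :=
      (measurable_threshold hT).comp measurable_prodMk_left
    refine .of_bound (by fun_prop) 1 (ae_of_all _ fun x => ?_)
    have hg0 : 0 ≤ ν.real {x | t ≤ T x} := measureReal_nonneg
    have hg1 : ν.real {x | t ≤ T x} ≤ 1 := measureReal_le_one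
    rw [Real.norm_eq_abs, abs_pow, sq_le_one_iff_abs_le_one, abs_abs]
    rcases threshold_eq_zero_or_one T t x with h | h <;> rw [h, abs_le] <;> constructor <;> linarith
  rw [integral_prod_coinLaw_eq ν
    ((measurable_noiseCombination_right ν hT α a b t).pow_const 2)
    (C := (|a| * ((Real.exp α + 1) / (Real.exp α - 1) + 1) + |b| * (bitDev ν T t)⁻¹) ^ 2)
    (fun z => by rw [abs_pow]; exact pow_le_pow_left₀ (abs_nonneg _) (hb z) 2)]
  simp_rw [integral_coinLaw_noiseCombination_sq ν hα]
  have hsq : bitDev ν T t ^ 2 = ν.real {x | t ≤ T x} * (1 - ν.real {x | t ≤ T x}) := by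
    rw [bitDev, Real.sq_sqrt]
    exact mul_nonneg measureReal_nonneg (sub_nonneg.2 measureReal_le_one)
  rw [integral_add (integrable_const _) (iV.const_mul _), integral_const, integral_const_mul,
    integral_threshold_sub_sq ν hT, ← hsq]
  simp
  field_simp

end Moments

end PrivateExpFamily

/-! ### The two error terms and their joint limit. -/

namespace PrivateExpFamily

variable {𝒳 : Type*} [MeasurableSpace 𝒳]

/-- Normalized contribution of the privacy noise to the mean report. -/
noncomputable def noiseError (α : ℝ) (T : 𝒳 → ℝ) (n : ℕ) (t : ℝ) (z : Fin n → 𝒳 × Bool) : ℝ :=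
  (√(n : ℝ))⁻¹ * ∑ i, (response α (threshold T t (z i).1) (z i).2 - threshold T t (z i).1)

/-- Normalized sampling error of the empirical frequency of the bits. -/
noncomputable def bitError (ν : Measure 𝒳) (T : 𝒳 → ℝ) (n : ℕ) (t : ℝ) (z : Fin n → 𝒳 × Bool) : ℝ :=
  (√(n : ℝ))⁻¹ * ∑ i, (threshold T t (z i).1 - ν.real {x | t ≤ T x})

/-- The bits cancel between the two sums, so the decomposition is exact and involves no remainder.
-/
lemma noiseError_add_bitError (ν : Measure 𝒳) (T : 𝒳 → ℝ) (α : ℝ) (n : ℕ) (t : ℝ)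
    (z : Fin n → 𝒳 × Bool) :
    noiseError α T n t z + bitError ν T n t z =
      √(n : ℝ) * (meanReport α T n t (fun i => (z i).1) (fun i => (z i).2) -
        ν.real {x | t ≤ T x}) := by
  rcases Nat.eq_zero_or_pos n with rfl | hn
  · simp [noiseError, bitError]
  have hn' : (0 : ℝ) < n := by exact_mod_cast hn
  have hs : (√(n : ℝ))⁻¹ * n = √(n : ℝ) := by
    have h2 := Real.mul_self_sqrt hn'.le
    have h0 : √(n : ℝ) ≠ 0 := (Real.sqrt_pos.2 hn').ne'
    rw [inv_mul_eq_iff_eq_mul₀ h0, h2]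
  have hs' : √(n : ℝ) * (1 / n) = (√(n : ℝ))⁻¹ := by
    nth_rw 1 [← hs]; field_simp
  rw [noiseError, bitError, ← mul_add, ← Finset.sum_add_distrib, meanReport, mul_sub, ← mul_assoc,
    hs']
  simp_rw [sub_add_sub_cancel]
  rw [Finset.sum_sub_distrib, mul_sub]
  congr 1
  simp [← mul_assoc, hs]

lemma measurable_noiseError {T : 𝒳 → ℝ} (hT : Measurable T) (α : ℝ) (n : ℕ) :
    Measurable fun p : ℝ × (Fin n → 𝒳 × Bool) => noiseError α T n p.1 p.2 := by
  have h1 : ∀ i, Measurable fun p : ℝ × (Fin n → 𝒳 × Bool) => threshold T p.1 (p.2 i).1 := fun i =>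
    (measurable_threshold hT).comp
      (measurable_fst.prodMk ((measurable_pi_apply i).comp measurable_snd).fst)
  have h2 : ∀ i, Measurable fun p : ℝ × (Fin n → 𝒳 × Bool) =>
      response α (threshold T p.1 (p.2 i).1) (p.2 i).2 := fun i =>
    (measurable_response α).comp
      ((h1 i).prodMk ((measurable_pi_apply i).comp measurable_snd).snd)
  exact (Finset.measurable_fun_sum _ fun i _ => (h2 i).sub (h1 i)).const_mul _

lemma measurable_bitError (ν : Measure 𝒳) [IsFiniteMeasure ν] {T : 𝒳 → ℝ} (hT : Measurable T)
    (n : ℕ) : Measurable fun p : ℝ × (Fin n → 𝒳 × Bool) => bitError ν T n p.1 p.2 := by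
  have h1 : ∀ i, Measurable fun p : ℝ × (Fin n → 𝒳 × Bool) => threshold T p.1 (p.2 i).1 := fun i =>
    (measurable_threshold hT).comp
      (measurable_fst.prodMk ((measurable_pi_apply i).comp measurable_snd).fst)
  have h2 : Measurable fun p : ℝ × (Fin n → 𝒳 × Bool) => ν.real {x | p.1 ≤ T x} :=
    (measurable_measureReal_le ν T).comp measurable_fst
  exact (Finset.measurable_fun_sum _ fun i _ => (h1 i).sub h2).const_mul _

lemma measurable_bitDev (ν : Measure 𝒳) [IsFiniteMeasure ν] (T : 𝒳 → ℝ) :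
    Measurable (bitDev ν T) := by
  have h := measurable_measureReal_le ν T
  exact (h.mul (h.const_sub 1)).sqrt

/-- The Cramér–Wold reduction: the joint characteristic function becomes that of one normalized sum,
i.i.d. once the threshold is fixed. -/
lemma linear_errors_eq (ν : Measure 𝒳) (T : 𝒳 → ℝ) (α a b : ℝ) (n : ℕ) (t : ℝ)
    (z : Fin n → 𝒳 × Bool) :
    a * noiseError α T n t z + b * (bitError ν T n t z / bitDev ν T t) =
      (√(n : ℝ))⁻¹ * ∑ i, noiseCombination ν T α a b t (z i) := by
  simp only [noiseError, bitError, noiseCombination]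
  rw [Finset.sum_add_distrib, ← Finset.mul_sum, ← Finset.mul_sum, ← Finset.sum_div]
  ring

section CLT

variable (ν : Measure 𝒳) [IsProbabilityMeasure ν] {T : 𝒳 → ℝ} {α : ℝ}
  {Ω : Type*} [MeasurableSpace Ω] (P : Measure Ω) [IsProbabilityMeasure P]

/-- Convergence of the joint characteristic functions of the two error terms. -/
lemma tendsto_integral_cexp_errors (hT : Measurable T) (hα : 0 < α)
    {τ : ℕ → Ω → ℝ} (hτ : ∀ n, Measurable (τ n)) {Z : (n : ℕ) → Fin n → Ω → 𝒳 × Bool}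
    (hZ : ∀ n i, Measurable (Z n i)) (hlaw : ∀ n i, P.map (Z n i) = ν.prod (coinLaw α))
    (hind : ∀ n, iIndepFun (Z n) P) (hτZ : ∀ n, IndepFun (τ n) (fun ω i => Z n i ω) P)
    {m : ℝ} (hm : TendstoInMeasure P τ atTop (fun _ => m)) {δ c : ℝ} (hδ : 0 < δ) (hc : 0 < c)
    (hdev : ∀ t, |t - m| < δ → c ≤ bitDev ν T t) (a b : ℝ) :
    Tendsto (fun n => ∫ ω, Complex.exp ((a * noiseError α T n (τ n ω) (fun i => Z n i ω) +
      b * (bitError ν T n (τ n ω) (fun i => Z n i ω) / bitDev ν T (τ n ω)) : ℝ) * Complex.I) ∂P)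
      atTop (𝓝 (Complex.exp (-(a ^ 2 * deltaSq α + b ^ 2) / 2 : ℝ))) := by
  have := isProbabilityMeasure_coinLaw α
  simp_rw [linear_errors_eq]
  have e : ∀ n : ℕ, ∫ ω, Complex.exp (((√(n : ℝ))⁻¹ *
      ∑ i, noiseCombination ν T α a b (τ n ω) (Z n i ω) : ℝ) * Complex.I) ∂P =
      ∫ ω, (∫ z, Complex.exp (((√(n : ℝ))⁻¹ * noiseCombination ν T α a b (τ n ω) z : ℝ) *
        Complex.I) ∂(ν.prod (coinLaw α))) ^ n ∂P := fun n =>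
    integral_cexp_sum_eq P (hτ n) (hZ n) (hlaw n) (hind n) (hτZ n)
      (measurable_noiseCombination ν hT α a b) _
  simp_rw [e]
  refine tendsto_integral_comp_of_tendstoInMeasure P hτ hm (φ := fun n t =>
    (∫ z, Complex.exp (((√(n : ℝ))⁻¹ * noiseCombination ν T α a b t z : ℝ) *
      Complex.I) ∂(ν.prod (coinLaw α))) ^ n) (fun n => ?_) (fun n t => ?_) ?_ hδ ?_
  · have h1 : Measurable fun p : ℝ × 𝒳 × Bool => noiseCombination ν T α a b p.1 p.2 :=
      measurable_noiseCombination ν hT α a b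
    have : StronglyMeasurable fun p : ℝ × 𝒳 × Bool =>
        Complex.exp (((√(n : ℝ))⁻¹ * noiseCombination ν T α a b p.1 p.2 : ℝ) * Complex.I) := by
      refine Measurable.stronglyMeasurable ?_
      fun_prop
    exact (this.integral_prod_right').measurable.pow_const n
  · rw [norm_pow]
    refine pow_le_one₀ (norm_nonneg _) ?_
    refine (norm_integral_le_of_norm_le_const (C := 1) (ae_of_all _ fun x => ?_)).trans (by simp)
    rw [Complex.norm_exp_ofReal_mul_I]
  · rw [Complex.norm_exp, Complex.ofReal_re, Real.exp_le_one_iff]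
    have : 0 ≤ deltaSq α := div_nonneg (Real.exp_pos _).le (sq_nonneg _)
    have : 0 ≤ a ^ 2 * deltaSq α + b ^ 2 := by positivity
    linarith
  · intro ε hε
    -- Both the bound, through `c ≤ bitDev`, and the variance are the same for every `t` within `δ`
    -- of `m`, so one rank `n` serves all these thresholds.
    filter_upwards [eventually_norm_integral_cexp_pow_sub_le (ν.prod (coinLaw α))
      (|a| * ((Real.exp α + 1) / (Real.exp α - 1) + 1) + |b| * c⁻¹)
      (a ^ 2 * deltaSq α + b ^ 2) hε] with n hn t ht
    have hpos := hc.trans_le (hdev t ht)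
    exact hn _ (measurable_noiseCombination_right ν hT α a b t)
      (abs_noiseCombination_le ν hα a b hc (hdev t ht))
      (integral_noiseCombination ν hT hα a b hpos)
      (integral_noiseCombination_sq ν hT hα a b hpos)

/-- Joint central limit theorem for the privacy noise and the standardized sampling error, at a
random threshold which is independent of the sample. -/
lemma tendstoInDistribution_errors (hT : Measurable T) (hα : 0 < α)
    {τ : ℕ → Ω → ℝ} (hτ : ∀ n, Measurable (τ n)) {Z : (n : ℕ) → Fin n → Ω → 𝒳 × Bool}
    (hZ : ∀ n i, Measurable (Z n i)) (hlaw : ∀ n i, P.map (Z n i) = ν.prod (coinLaw α))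
    (hind : ∀ n, iIndepFun (Z n) P) (hτZ : ∀ n, IndepFun (τ n) (fun ω i => Z n i ω) P)
    {m : ℝ} (hm : TendstoInMeasure P τ atTop (fun _ => m)) {δ c : ℝ} (hδ : 0 < δ) (hc : 0 < c)
    (hdev : ∀ t, |t - m| < δ → c ≤ bitDev ν T t) :
    TendstoInDistribution (fun n ω => (noiseError α T n (τ n ω) (fun i => Z n i ω),
      bitError ν T n (τ n ω) (fun i => Z n i ω) / bitDev ν T (τ n ω))) atTop
      (id : ℝ × ℝ → ℝ × ℝ) (fun _ => P)
      ((gaussianReal 0 (deltaSq α).toNNReal).prod (gaussianReal 0 1)) := by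
  set U : ℕ → Ω → ℝ × ℝ := fun n ω => (noiseError α T n (τ n ω) (fun i => Z n i ω),
      bitError ν T n (τ n ω) (fun i => Z n i ω) / bitDev ν T (τ n ω)) with hU
  have hp : ∀ n, Measurable fun ω => (τ n ω, fun i => Z n i ω) := fun n =>
    (hτ n).prodMk (measurable_pi_lambda _ (hZ n))
  have hUm : ∀ n, Measurable (U n) := fun n =>
    ((measurable_noiseError hT α n).comp (hp n)).prodMk
      (((measurable_bitError ν hT n).comp (hp n)).div ((measurable_bitDev ν T).comp (hτ n)))
  have hLm : Measurable (WithLp.toLp 2 : ℝ × ℝ → WithLp 2 (ℝ × ℝ)) :=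
    (WithLp.prod_continuous_toLp 2 ℝ ℝ).measurable
  have hδ0 : 0 ≤ deltaSq α := div_nonneg (Real.exp_pos _).le (sq_nonneg _)
  -- Characteristic functions refer to an inner product, hence the passage to `WithLp 2`; continuous
  -- mapping then returns to `ℝ × ℝ`.
  have key : TendstoInDistribution (fun n ω => WithLp.toLp 2 (U n ω)) atTop
      (WithLp.toLp 2 : ℝ × ℝ → WithLp 2 (ℝ × ℝ)) (fun _ => P)
      ((gaussianReal 0 (deltaSq α).toNNReal).prod (gaussianReal 0 1)) := by
    refine ⟨fun n => (hLm.comp (hUm n)).aemeasurable, hLm.aemeasurable, ?_⟩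
    refine ProbabilityMeasure.tendsto_iff_tendsto_charFun.2 fun s => ?_
    simp only [ProbabilityMeasure.coe_mk]
    rw [charFun_prod, charFun_gaussianReal, charFun_gaussianReal]
    have e1 : ∀ n, charFun (P.map (fun ω => WithLp.toLp 2 (U n ω))) s =
        ∫ ω, Complex.exp ((s.ofLp.1 * (U n ω).1 + s.ofLp.2 * (U n ω).2 : ℝ) * Complex.I) ∂P := by
      intro n
      rw [charFun_apply, integral_map (φ := fun ω => WithLp.toLp 2 (U n ω))
        (hLm.comp (hUm n)).aemeasurable
        (Measurable.aestronglyMeasurable (by fun_prop))]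
      simp only [WithLp.prod_inner_apply, RCLike.inner_apply, conj_trivial]
    simp_rw [e1]
    convert tendsto_integral_cexp_errors ν P hT hα hτ hZ hlaw hind hτZ hm hδ hc hdev
      s.ofLp.1 s.ofLp.2 using 2
    rw [← Complex.exp_add]
    congr 1
    simp only [Real.coe_toNNReal _ hδ0, NNReal.coe_one]
    push_cast
    ring
  have := key.continuous_comp (WithLp.prod_continuous_ofLp 2 ℝ ℝ)
  exact this

end CLT

/-! ### Tightness and transfer to the estimator. -/

/-- Sequences converging in distribution are bounded in probability. -/
lemma exists_eventually_measure_norm_ge_lt {E : Type*} [NormedAddCommGroup E] [MeasurableSpace E]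
    [BorelSpace E] {Ω Ω' : Type*} [MeasurableSpace Ω] [MeasurableSpace Ω'] {P : Measure Ω}
    [IsProbabilityMeasure P] {Q : Measure Ω'} [IsProbabilityMeasure Q] {U : ℕ → Ω → E} {V : Ω' → E}
    (hU : TendstoInDistribution U atTop V (fun _ => P) Q) {ε : ENNReal} (hε : 0 < ε) :
    ∃ K : ℝ, 0 ≤ K ∧ ∀ᶠ n in atTop, P {ω | K ≤ ‖U n ω‖} < ε := by
  have hQ := Measure.isProbabilityMeasure_map (μ := Q) hU.aemeasurable_limit
  have hlim : Tendsto (fun k : ℕ => Q.map V {x | (k : ℝ) ≤ ‖x‖}) atTop (𝓝 0) := by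
    have h := tendsto_measure_iInter_atTop (μ := Q.map V)
      (s := fun k : ℕ => {x : E | (k : ℝ) ≤ ‖x‖})
      (fun k => (isClosed_le continuous_const continuous_norm).measurableSet.nullMeasurableSet)
      (fun i j hij x hx => by
        have : (i : ℝ) ≤ j := by exact_mod_cast hij
        exact this.trans hx) ⟨0, measure_ne_top _ _⟩
    have he : ⋂ k : ℕ, {x : E | (k : ℝ) ≤ ‖x‖} = ∅ := by
      ext x
      simp only [Set.mem_iInter, Set.mem_ofPred_eq, Set.mem_empty_iff_false, iff_false, not_forall,
        not_le]
      exact exists_nat_gt ‖x‖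
    rwa [he, measure_empty] at h
  obtain ⟨k, hk⟩ := (hlim.eventually_lt_const hε).exists
  have hcl : IsClosed {x : E | (k : ℝ) ≤ ‖x‖} := isClosed_le continuous_const continuous_norm
  refine ⟨k, Nat.cast_nonneg k, ?_⟩
  -- Portmanteau for closed sets, which is why the tail event uses a non-strict inequality.
  have h := ProbabilityMeasure.limsup_measure_closed_le_of_tendsto hU.tendsto hcl
  have h' := eventually_lt_of_limsup_lt (h.trans_lt hk)
  filter_upwards [h'] with n hn
  simp only [ProbabilityMeasure.coe_mk] at hn
  rwa [Measure.map_apply_of_aemeasurable (hU.forall_aemeasurable n) hcl.measurableSet] at hn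

lemma measurable_noiseError_comp {𝒳 Ω : Type*} [MeasurableSpace 𝒳] [MeasurableSpace Ω] {T : 𝒳 → ℝ}
    (hT : Measurable T) (α : ℝ) {n : ℕ} {τ : Ω → ℝ} (hτ : Measurable τ) {Z : Fin n → Ω → 𝒳 × Bool}
    (hZ : ∀ i, Measurable (Z i)) : Measurable fun ω => noiseError α T n (τ ω) fun i => Z i ω := by
  have h := (measurable_noiseError hT α n).comp (hτ.prodMk (measurable_pi_lambda _ hZ))
  exact h

lemma measurable_bitError_comp {𝒳 Ω : Type*} [MeasurableSpace 𝒳] [MeasurableSpace Ω]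
    (ν : Measure 𝒳) [IsFiniteMeasure ν] {T : 𝒳 → ℝ} (hT : Measurable T) {n : ℕ} {τ : Ω → ℝ}
    (hτ : Measurable τ) {Z : Fin n → Ω → 𝒳 × Bool} (hZ : ∀ i, Measurable (Z i)) :
    Measurable fun ω => bitError ν T n (τ ω) fun i => Z i ω := by
  have h := (measurable_bitError ν hT n).comp (hτ.prodMk (measurable_pi_lambda _ hZ))
  exact h

/-- With probability tending to one the estimator is finite and given by its linear expansion. -/
lemma tendsto_measure_not_expansion {𝒳 : Type*} [MeasurableSpace 𝒳] (μ : Measure 𝒳) [NeZero μ]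
    {T : 𝒳 → ℝ} (hT : Measurable T) {Θ : Set ℝ} (hΘ : Θ ⊆ integrableExpSet T μ) {θ₀ : ℝ}
    (hθ₀ : θ₀ ∈ interior Θ) (hvar : 0 < variance T (expFamily μ T θ₀)) {α : ℝ}
    {Ω : Type*} [MeasurableSpace Ω] {P : Measure Ω} [IsProbabilityMeasure P]
    {τ : ℕ → Ω → ℝ} {Z : (n : ℕ) → Fin n → Ω → 𝒳 × Bool}
    (hτ : TendstoInMeasure P τ atTop (fun _ => ∫ x, T x ∂(expFamily μ T θ₀)))
    {δ c : ℝ} (hδ : 0 < δ) (hc : 0 < c)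
    (hdev : ∀ t, |t - ∫ x, T x ∂(expFamily μ T θ₀)| < δ → c ≤ bitDev (expFamily μ T θ₀) T t)
    {Ω' : Type*} [MeasurableSpace Ω'] {Q : Measure Ω'} [IsProbabilityMeasure Q] {V : Ω' → ℝ × ℝ}
    (hclt : TendstoInDistribution (fun n ω => (noiseError α T n (τ n ω) (fun i => Z n i ω),
      bitError (expFamily μ T θ₀) T n (τ n ω) (fun i => Z n i ω) /
        bitDev (expFamily μ T θ₀) T (τ n ω))) atTop V (fun _ => P) Q)
    {ε : ℝ} (hε : 0 < ε) :
    Tendsto (fun n : ℕ => P {ω | ¬ ∃ θ : ℝ, estimator μ T Θ α n (τ n ω)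
        (fun i => (Z n i ω).1) (fun i => (Z n i ω).2) = θ ∧
      |√(n : ℝ) * (θ - θ₀) - 2 * (l1Information μ T θ₀)⁻¹ *
        (noiseError α T n (τ n ω) (fun i => Z n i ω) +
          bitError (expFamily μ T θ₀) T n (τ n ω) (fun i => Z n i ω))| ≤ ε}) atTop (𝓝 0) := by
  have hν := isProbabilityMeasure_expFamily μ T (interior_subset (interior_mono hΘ hθ₀))
  rw [ENNReal.tendsto_nhds_zero]
  intro η hη
  obtain ⟨K, hK, hUK⟩ := exists_eventually_measure_norm_ge_lt hclt (ENNReal.half_pos hη.ne')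
  -- `2K` because `|E₁|` and `|E₂|` are each at most `K` on the good event; for `E₂` this uses that
  -- the standard deviation of a bit is at most `1`.
  obtain ⟨δ', hδ', hinv⟩ :=
    exists_invPsi_expansion μ hT hΘ hθ₀ hvar hε (by positivity : 0 ≤ 2 * K)
  have hτ' := (tendstoInMeasure_iff_dist.1 hτ (min δ δ') (lt_min hδ hδ')).eventually_lt_const
    (ENNReal.half_pos hη.ne')
  filter_upwards [hUK, hinv, hτ'] with n h1 h2 h3
  refine (measure_mono ?_).trans ((measure_union_le _ _).trans
    ((add_le_add h1.le h3.le).trans_eq (ENNReal.add_halves η)))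
  intro ω hω
  by_contra hgood
  simp only [Set.mem_union, Set.mem_ofPred_eq, not_or, not_le, Real.dist_eq, lt_min_iff,
    Prod.norm_def, max_lt_iff, Real.norm_eq_abs] at hgood
  obtain ⟨⟨hn, hb⟩, ht, ht'⟩ := hgood
  refine hω ?_
  have hpos := hc.trans_le (hdev _ ht)
  have hle : bitDev (expFamily μ T θ₀) T (τ n ω) ≤ 1 := by
    have hg0 : 0 ≤ (expFamily μ T θ₀).real {x | τ n ω ≤ T x} := measureReal_nonneg
    have hg1 : (expFamily μ T θ₀).real {x | τ n ω ≤ T x} ≤ 1 := measureReal_le_one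
    refine Real.sqrt_le_one.2 ?_
    nlinarith
  have hb' : |bitError (expFamily μ T θ₀) T n (τ n ω) (fun i => Z n i ω)| ≤ K := by
    rw [abs_div, abs_of_pos hpos, div_lt_iff₀ hpos] at hb
    exact hb.le.trans (mul_le_of_le_one_right hK hle)
  have e := noiseError_add_bitError (expFamily μ T θ₀) T α n (τ n ω) (fun i => Z n i ω)
  rw [e]
  refine h2 _ _ ht'.le ?_
  change |√(n : ℝ) * (_ - (expFamily μ T θ₀).real {x | τ n ω ≤ T x})| ≤ _
  rw [← e]
  refine (abs_add_le _ _).trans ?_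
  linarith

end PrivateExpFamily

theorem proposition5
    {𝒳 : Type*} [MeasurableSpace 𝒳] (μ : Measure 𝒳) (T : 𝒳 → ℝ) (hT : Measurable T)
    -- the parameter set, inside the natural parameter space
    (Θ : Set ℝ) (hΘ : Θ ⊆ integrableExpSet T μ)
    (θ₀ : ℝ) (hθ₀ : θ₀ ∈ interior Θ)
    (hvar : 0 < variance T (PrivateExpFamily.expFamily μ T θ₀))
    (α : ℝ) (hα : 0 < α)
    {Ω : Type*} [MeasurableSpace Ω] (P : Measure Ω) [IsProbabilityMeasure P]
    -- the first-stage estimates, and the observations and coins of the second stage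
    (That : ℕ → Ω → ℝ) (X : (n : ℕ) → Fin n → Ω → 𝒳) (B : (n : ℕ) → Fin n → Ω → Bool)
    (hThat_meas : ∀ n, Measurable (That n))
    (hX_meas : ∀ n i, Measurable (X n i)) (hB_meas : ∀ n i, Measurable (B n i))
    (hX_law : ∀ n i, P.map (X n i) = PrivateExpFamily.expFamily μ T θ₀)
    (hB_law : ∀ n i, P.map (B n i) = PrivateExpFamily.coinLaw α)
    -- for each `n`, the first-stage estimate, the observations and the coins are independent
    (hXB_indep : ∀ n i, IndepFun (X n i) (B n i) P)
    (h_indep : ∀ n, iIndepFun (fun (i : Fin n) (ω : Ω) => (X n i ω, B n i ω)) P)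
    (hThat_indep : ∀ n,
      IndepFun (That n) (fun (ω : Ω) (i : Fin n) => (X n i ω, B n i ω)) P)
    -- consistency of the first stage
    (hThat : TendstoInMeasure P That atTop
      (fun _ => ∫ x, T x ∂(PrivateExpFamily.expFamily μ T θ₀))) :
    -- privacy of the second stage
    (∀ t : ℝ, PrivateExpFamily.IsLocallyDP α (PrivateExpFamily.channel α T t)) ∧
    -- the estimator is finite with probability tending to one
    Tendsto (fun n : ℕ => P {ω |
        PrivateExpFamily.estimator μ T Θ α n (That n ω)
            (fun i => X n i ω) (fun i => B n i ω) = ⊤ ∨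
        PrivateExpFamily.estimator μ T Θ α n (That n ω)
            (fun i => X n i ω) (fun i => B n i ω) = ⊥})
      atTop (𝓝 0) ∧
    ∃ G E₁ E₂ : ℕ → Ω → ℝ,
      (∀ n, Measurable (G n)) ∧ (∀ n, Measurable (E₁ n)) ∧ (∀ n, Measurable (E₂ n)) ∧
      (∀ n ω, G n ω = PrivateExpFamily.Psi μ T (That n ω) θ₀) ∧
      (∀ n ω, G n ω ∈ Set.Icc (0 : ℝ) 1) ∧
      -- the asymptotic expansion
      TendstoInMeasure P
        (fun (n : ℕ) (ω : Ω) =>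
          √(n : ℝ) * ((PrivateExpFamily.estimator μ T Θ α n (That n ω)
            (fun i => X n i ω) (fun i => B n i ω)).toReal - θ₀)
          - 2 * (PrivateExpFamily.l1Information μ T θ₀)⁻¹ * (E₁ n ω + E₂ n ω))
        atTop (fun _ => 0) ∧
      -- joint convergence in distribution to `N(0, diag(δ_α², 1))`
      TendstoInDistribution
        (fun (n : ℕ) (ω : Ω) => (E₁ n ω, E₂ n ω / √(G n ω * (1 - G n ω))))
        atTop (id : ℝ × ℝ → ℝ × ℝ) (fun _ => P)
        ((gaussianReal 0 (PrivateExpFamily.deltaSq α).toNNReal).prod (gaussianReal 0 1)) := by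
  have hint : θ₀ ∈ interior (integrableExpSet T μ) := interior_mono hΘ hθ₀
  -- The zero measure would give `T` variance zero.
  have hμ : NeZero μ := by
    refine ⟨fun h => hvar.ne' ?_⟩
    simp [PrivateExpFamily.expFamily, h]
  have hν := PrivateExpFamily.isProbabilityMeasure_expFamily μ T (interior_subset hint)
  have hcoin := PrivateExpFamily.isProbabilityMeasure_coinLaw α
  have iT : Integrable T (PrivateExpFamily.expFamily μ T θ₀) :=
    integrable_of_mem_interior_integrableExpSet
      (PrivateExpFamily.zero_mem_interior_expFamily μ T hint)
  obtain ⟨δ, hδ, c, hc, hdev⟩ :=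
    PrivateExpFamily.exists_le_prob_mul_one_sub (PrivateExpFamily.expFamily μ T θ₀) hT iT hvar
  have hdev' : ∀ t, |t - ∫ x, T x ∂(PrivateExpFamily.expFamily μ T θ₀)| < δ →
      √c ≤ PrivateExpFamily.bitDev (PrivateExpFamily.expFamily μ T θ₀) T t :=
    fun t ht => Real.sqrt_le_sqrt (hdev t ht)
  have hZ : ∀ n i, Measurable fun ω => (X n i ω, B n i ω) := fun n i =>
    (hX_meas n i).prodMk (hB_meas n i)
  have hlaw : ∀ n i, P.map (fun ω => (X n i ω, B n i ω)) =
      (PrivateExpFamily.expFamily μ T θ₀).prod (PrivateExpFamily.coinLaw α) := fun n i => by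
    rw [(indepFun_iff_map_prod_eq_prod_map_map (hX_meas n i).aemeasurable
      (hB_meas n i).aemeasurable).1 (hXB_indep n i), hX_law, hB_law]
  have hclt := PrivateExpFamily.tendstoInDistribution_errors
    (PrivateExpFamily.expFamily μ T θ₀) (Z := fun n i ω => (X n i ω, B n i ω)) P hT hα hThat_meas
    hZ hlaw h_indep hThat_indep hThat hδ (Real.sqrt_pos.2 hc) hdev'
  have hexp := fun (ε : ℝ) (hε : 0 < ε) =>
    PrivateExpFamily.tendsto_measure_not_expansion (Z := fun n i ω => (X n i ω, B n i ω))
      μ hT hΘ hθ₀ hvar hThat hδ (Real.sqrt_pos.2 hc) hdev' hclt hε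
  have hG : ∀ n, Measurable fun ω => PrivateExpFamily.Psi μ T (That n ω) θ₀ := fun n =>
    (PrivateExpFamily.measurable_measureReal_le
      (PrivateExpFamily.expFamily μ T θ₀) T).comp (hThat_meas n)
  have hG0 : ∀ t, 0 ≤ PrivateExpFamily.Psi μ T t θ₀ := fun t => measureReal_nonneg
  have hG1 : ∀ t, PrivateExpFamily.Psi μ T t θ₀ ≤ 1 := fun t => measureReal_le_one
  have hE₁ := fun n => PrivateExpFamily.measurable_noiseError_comp hT α (hThat_meas n) (hZ n)
  have hE₂ := fun n => PrivateExpFamily.measurable_bitError_comp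
    (PrivateExpFamily.expFamily μ T θ₀) hT (hThat_meas n) (hZ n)
  refine ⟨fun t => PrivateExpFamily.isLocallyDP_channel hα.le T t, ?_,
    fun n ω => PrivateExpFamily.Psi μ T (That n ω) θ₀,
    fun n ω => PrivateExpFamily.noiseError α T n (That n ω) fun i => (X n i ω, B n i ω),
    fun n ω => PrivateExpFamily.bitError (PrivateExpFamily.expFamily μ T θ₀) T n (That n ω)
      fun i => (X n i ω, B n i ω), ?_, ?_, ?_, ?_, ?_, ?_, ?_⟩
  -- The expansion event already contains finiteness, so any tolerance would do.
  · refine tendsto_of_tendsto_of_tendsto_of_le_of_le tendsto_const_nhds (hexp 1 one_pos)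
      (fun n => zero_le) fun n => measure_mono ?_
    rintro ω hω ⟨θ, hθ, -⟩
    change PrivateExpFamily.estimator μ T Θ α n (That n ω) (fun i => X n i ω)
      (fun i => B n i ω) = θ at hθ
    simp only [Set.mem_ofPred_eq, hθ] at hω
    rcases hω with h | h
    · exact EReal.coe_ne_top _ h
    · exact EReal.coe_ne_bot _ h
  · exact hG
  · exact hE₁
  · exact hE₂
  · exact fun _ _ => rfl
  · exact fun n ω => ⟨hG0 (That n ω), hG1 (That n ω)⟩
  · rw [tendstoInMeasure_iff_dist]
    intro ε hε
    -- The deviation event is `ε ≤ dist`, so the tolerance `ε / 2` leaves strict room. An infinite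
    -- estimator, where `toReal` takes the value `0`, falls in the exceptional event.
    refine tendsto_of_tendsto_of_tendsto_of_le_of_le tendsto_const_nhds (hexp (ε / 2) (half_pos hε))
      (fun n => zero_le) fun n => measure_mono ?_
    rintro ω hω ⟨θ, hθ, hb⟩
    change PrivateExpFamily.estimator μ T Θ α n (That n ω) (fun i => X n i ω)
      (fun i => B n i ω) = θ at hθ
    simp only [Set.mem_ofPred_eq, hθ, EReal.toReal_coe, Real.dist_eq, sub_zero] at hω
    linarith
  · exact hclt
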